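/- Fix $\tau,\eta\in\mathbb C$ with $\operatorname{Im}\tau>0$ and let $$\theta(t)=-\sum_{j\in\mathbb Z}e^{\pi i(j+\frac12)^2\tau+2\pi i(j+\frac12)(t+\frac12)},\quad \alpha(z,\lambda)=\frac{\theta(\lambda+2\eta)\theta(z)}{\theta(\lambda)\theta(z-2\eta)},\quad \beta(z,\lambda)=-\frac{\theta(\lambda+z)\theta(2\eta)}{\theta(\lambda)\theta(z-2\eta)}.$$ Let $V$ have basis $e[1],e[-1]$, $E_{ij}e[k]=\delta_{jk}e[i]$, $h=E_{11}-E_{-1,-1}$, and let $R(z,\lambda)\in\operatorname{End}(V\otimes V)$ be $$R(z,\lambda)=E_{11}\otimes E_{11}+E_{-1,-1}\otimes E_{-1,-1}+\alpha(z,\lambda)E_{11}\otimes E_{-1,-1}+\alpha(z,-\lambda)E_{-1,-1}\otimes E_{11}+\beta(z,\lambda)E_{1,-1}\otimes E_{-1,1}+\beta(z,-\lambda)E_{-1,1}\otimes E_{1,-1}.$$ A module over $E_{\tau,\eta}(sl_2)$ is a complex vector space $W=\bigoplus_{\mu\in\mathbb C}W[\mu]$, the direct sum of finite-dimensional eigenspaces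 $W[\mu]$ of an operator $h$, with an operator $L(z,\lambda)\in\operatorname{End}(V\otimes W)$ commuting with $h^{(1)}+h^{(2)}$, meromorphic in $(z,\lambda)\in\mathbb C^2$, such that $$R^{(12)}(z-w,\lambda-2\eta h^{(3)})L^{(13)}(z,\lambda)L^{(23)}(w,\lambda-2\eta h^{(1)})=L^{(23)}(w,\lambda)L^{(13)}(z,\lambda-2\eta h^{(2)})R^{(12)}(z-w,\lambda)$$ in $\operatorname{End}(V\otimes V\otimes W)$. Let $\operatorname{Fun}(W)$ be the space of $W$-valued meromorphic functions of $\lambda$ and $\operatorname{Fun}(W)[\mu]$ the subspace of those with values in $W[\mu]$. Call $z$ regular if $L$ has no pole along $\{z\}\times\mathbb C$; for such $z$ put $(\tilde L(z)(e[\mu]\otimes f))(\lambda)=L(z,\lambda)(e[\mu]\otimes f(\lambda-2\eta\mu))$ for $\mu=\pm1$ and define operators $a(z),b(z),c(z),d(z)$ on $\operatorname{Fun}(W)$ by $$\tilde L(z)(e[1]\otimes f)=e[1]\otimes a(z)f+e[-1]\otimes c(z)f,\qquad \tilde L(z)(e[-1]\otimes f)=e[1]\otimes b(z)f+e[-1]\otimes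 d(z)f.$$ Let $T(z)=a(z)+d(z)$. The module $W$ is a highest weight module of highest weight $(\Lambda,A,D)$ if there is a non-zero $v_0\in\operatorname{Fun}(W)[\Lambda]$ with $c(z)v_0=0$, $a(z)v_0=A(z,\lambda)v_0$, $d(z)v_0=D(z,\lambda)v_0$, and $\operatorname{Fun}(W)$ is spanned over the field of meromorphic functions of $\lambda$ by the vectors $b(s_1)\cdots b(s_r)v_0$, $r\ge0$. **Theorem.** Let $z_1,\dots,z_n,\Lambda_1,\dots,\Lambda_n\in\mathbb C$, $p_j=z_j+\eta(-\Lambda_j+1)$, $q_j=z_j+\eta(\Lambda_j+1)$, and suppose $\Lambda=\sum_j\Lambda_j=2m$ with $m\in\mathbb Z_{\ge0}$. Let $W$ be a highest weight module of highest weight $(\Lambda,A,D)$ with $$A(z,\lambda)=1,\qquad D(z,\lambda)=\frac{\theta(\lambda-2\eta\Lambda)}{\theta(\lambda)}\prod_{j=1}^n\frac{\theta(z-p_j)}{\theta(z-q_j)},$$ and highest weight vector $v_0$. Let $c\in\mathbb C$ and $v(\lambda)=e^{c\lambda}\prod_{j=1}^m\theta(\lambda-2\eta j)\,v_0(\lambda)$.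 Let $t_1,\dots,t_m$ be regular points, pairwise distinct modulo $\mathbb Z+\tau\mathbb Z$, that solve the Bethe ansatz equations (all denominators being non-zero) $$\prod_{j\ne i}\frac{\theta(t_j-t_i-2\eta)}{\theta(t_j-t_i+2\eta)}\prod_{k=1}^n\frac{\theta(t_i-q_k)}{\theta(t_i-p_k)}=e^{4\eta c},\qquad i=1,\dots,m.$$ Then $\psi=b(t_1)\cdots b(t_m)v$ lies in $H=\operatorname{Fun}(W)[0]$, and $T(w)\psi=\epsilon(w)\psi$ for every regular $w$, where $$\epsilon(w)=e^{-2\eta c}\prod_{j=1}^m\frac{\theta(t_j-w-2\eta)}{\theta(t_j-w)}+e^{2\eta c}\prod_{j=1}^m\frac{\theta(t_j-w+2\eta)}{\theta(t_j-w)}\prod_{k=1}^n\frac{\theta(w-p_k)}{\theta(w-q_k)};$$ at regular points $w$ where a denominator of this formula vanishes, $\epsilon$ has a removable singularity and $\epsilon(w)$ denotes the limit. (So $\psi$ is a common eigenvector of all transfer matrices whenever it is not zero.) -/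

import Mathlib

open Filter Topology
open scoped Kronecker

noncomputable section

namespace EllipticBethe

/-! ### Theta function and the dynamical R-matrix -/

/-- Jacobi's (odd) theta function
`θ(t) = -∑_{j ∈ ℤ} exp(πi (j+1/2)² τ + 2πi (j+1/2)(t+1/2))`. -/
def theta (τ t : ℂ) : ℂ :=
  -∑' j : ℤ, Complex.exp (Real.pi * Complex.I * ((j : ℂ) + 1 / 2) ^ 2 * τ
    + 2 * Real.pi * Complex.I * ((j : ℂ) + 1 / 2) * (t + 1 / 2))

/-- `α(z,λ) = θ(λ+2η)θ(z) / (θ(λ)θ(z-2η))`. -/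
def alpha (τ η z l : ℂ) : ℂ :=
  theta τ (l + 2 * η) * theta τ z / (theta τ l * theta τ (z - 2 * η))

/-- `β(z,λ) = -θ(λ+z)θ(2η) / (θ(λ)θ(z-2η))`. -/
def beta (τ η z l : ℂ) : ℂ :=
  -(theta τ (l + z) * theta τ (2 * η)) / (theta τ l * theta τ (z - 2 * η))

/-- The basis vectors `e[1]`, `e[-1]` of `V` are indexed by `0, 1 : Fin 2`;
`wt` is the corresponding eigenvalue of `h`. -/
def wt (i : Fin 2) : ℂ := if i = 0 then 1 else -1

/-- The matrix unit `E_{ij}`, `E_{ij} e_k = δ_{jk} e_i`. -/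
def E (i j : Fin 2) : Matrix (Fin 2) (Fin 2) ℂ := Matrix.single i j 1

/-- The R-matrix `R(z,λ) ∈ End(V ⊗ V)`; the entry `R (k,l) (i,j)` is the coefficient of
`e_k ⊗ e_l` in `R(z,λ)(e_i ⊗ e_j)`. -/
def R (τ η z l : ℂ) : Matrix (Fin 2 × Fin 2) (Fin 2 × Fin 2) ℂ :=
  E 0 0 ⊗ₖ E 0 0 + E 1 1 ⊗ₖ E 1 1
    + alpha τ η z l • (E 0 0 ⊗ₖ E 1 1) + alpha τ η z (-l) • (E 1 1 ⊗ₖ E 0 0)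
    + beta τ η z l • (E 0 1 ⊗ₖ E 1 0) + beta τ η z (-l) • (E 1 0 ⊗ₖ E 0 1)

/-! ### Meromorphic functions

A meromorphic function is represented by an everywhere defined function whose values on the polar
set carry no information; two functions of one variable represent the same meromorphic function
iff they agree on a codiscrete set, and identities between meromorphic functions of several
variables are required on a set with dense interior. -/

/-- Meromorphic functions of two complex variables: locally quotients of holomorphic functions
(with denominator not identically zero), off the zero set of the denominator. -/
def Meromorphic₂ (f : ℂ × ℂ → ℂ) : Prop :=
  ∀ x, ∃ g h : ℂ × ℂ → ℂ, AnalyticAt ℂ g x ∧ AnalyticAt ℂ h x ∧ (¬ ∀ᶠ y in 𝓝 x, h y = 0) ∧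
    ∀ᶠ y in 𝓝 x, h y ≠ 0 → f y = g y / h y

section Vector

variable {W : Type*} [AddCommGroup W] [Module ℂ W]

/-- `F ∈ Fun(W)`: meromorphic functions of one variable with values in `W`. -/
def MeroFun (F : ℂ → W) : Prop :=
  ∃ (k : ℕ) (f : Fin k → ℂ → ℂ) (u : Fin k → W),
    (∀ i, Meromorphic (f i)) ∧ ∀ x, F x = ∑ i, f i x • u i

/-- Meromorphic functions of two variables with values in `W`. -/
def MeroFun₂ (F : ℂ × ℂ → W) : Prop :=
  ∃ (k : ℕ) (f : Fin k → ℂ × ℂ → ℂ) (u : Fin k → W),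
    (∀ i, Meromorphic₂ (f i)) ∧ ∀ x, F x = ∑ i, f i x • u i

/-- A `W`-valued function of two variables is holomorphic near `x`. -/
def HolAt (F : ℂ × ℂ → W) (x : ℂ × ℂ) : Prop :=
  ∃ (k : ℕ) (f : Fin k → ℂ × ℂ → ℂ) (u : Fin k → W),
    (∀ i, AnalyticAt ℂ (f i) x) ∧ ∀ᶠ y in 𝓝 x, F y = ∑ i, f i y • u i

end Vector

/-! ### Modules over the elliptic quantum group -/

/-- A module over `E_{τ,η}(sl₂)`: a diagonalizable `h`-module `W` with finite dimensional weight
spaces and a meromorphic `L`-operator. The operator `L(z,λ) ∈ End(V ⊗ W)` is given by its matrix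
over `End W`: `L(z,λ)(e_j ⊗ u) = ∑_i e_i ⊗ L z λ i j u`. -/
structure EModule (τ η : ℂ) (W : Type*) [AddCommGroup W] [Module ℂ W] where
  h : Module.End ℂ W
  finite_weight : ∀ μ : ℂ, FiniteDimensional ℂ (h.eigenspace μ)
  diagonalizable : ⨆ μ : ℂ, h.eigenspace μ = ⊤
  L : ℂ → ℂ → Fin 2 → Fin 2 → Module.End ℂ W
  /-- `L(z,λ)` commutes with `h⁽¹⁾ + h⁽²⁾`. -/
  L_weight : ∀ z l i j μ, ∀ u ∈ h.eigenspace μ, L z l i j u ∈ h.eigenspace (μ + wt j - wt i)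
  L_mero : ∀ i j u, MeroFun₂ fun x : ℂ × ℂ => L x.1 x.2 i j u
  /-- The relation
  `R⁽¹²⁾(z-w,λ-2ηh⁽³⁾) L⁽¹³⁾(z,λ) L⁽²³⁾(w,λ-2ηh⁽¹⁾)
    = L⁽²³⁾(w,λ) L⁽¹³⁾(z,λ-2ηh⁽²⁾) R⁽¹²⁾(z-w,λ)`
  in `End(V ⊗ V ⊗ W)`: both sides are applied to `e_i ⊗ e_j ⊗ u` with `u` of weight `μ`, and the
  coefficients of `e_{i'} ⊗ e_{j'}` are compared. The vector `L⁽¹³⁾ L⁽²³⁾ u` standing next to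
  `e_k ⊗ e_l` has weight `μ + wt i + wt j - wt k - wt l`. -/
  RLL : ∀ (i j i' j' : Fin 2) (μ : ℂ), ∀ u ∈ h.eigenspace μ,
    Dense (interior {x : ℂ × ℂ × ℂ | ∀ z w lam : ℂ, x = (z, w, lam) →
      ∑ k, ∑ l, R τ η (z - w) (lam - 2 * η * (μ + wt i + wt j - wt k - wt l)) (i', j') (k, l) •
          L z lam k i (L w (lam - 2 * η * wt i) l j u)
        = ∑ k, ∑ l, R τ η (z - w) lam (k, l) (i, j) •
          L w lam j' l (L z (lam - 2 * η * wt l) i' k u)})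

namespace EModule

variable {τ η : ℂ} {W : Type*} [AddCommGroup W] [Module ℂ W] (M : EModule τ η W)

/-- `z` is a regular value of the spectral parameter: `L` has no pole along `{z} × ℂ`, so that the
operators `a(z), b(z), c(z), d(z)` on `Fun(W)` are defined. On each vector, `L(z,·)` is then a
meromorphic function, and `L` is holomorphic at `(z,λ)` for all `λ` outside a discrete set. -/
def IsRegular (z : ℂ) : Prop :=
  ∀ i j u, MeroFun (fun l => M.L z l i j u) ∧
    ∀ᶠ l in codiscrete ℂ, HolAt (fun x : ℂ × ℂ => M.L x.1 x.2 i j u) (z, l)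

/-- The matrix entries of `L̃(z)`, where
`(L̃(z)(e_j ⊗ f))(λ) = L(z,λ)(e_j ⊗ f(λ - 2η wt j))`. -/
def entry (i j : Fin 2) (z : ℂ) (f : ℂ → W) : ℂ → W :=
  fun l => M.L z l i j (f (l - 2 * η * wt j))

def a (z : ℂ) (f : ℂ → W) : ℂ → W := M.entry 0 0 z f

def b (z : ℂ) (f : ℂ → W) : ℂ → W := M.entry 0 1 z f

def c (z : ℂ) (f : ℂ → W) : ℂ → W := M.entry 1 0 z f

def d (z : ℂ) (f : ℂ → W) : ℂ → W := M.entry 1 1 z f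

/-- The transfer matrix `T(z) = a(z) + d(z)`. -/
def T (z : ℂ) (f : ℂ → W) : ℂ → W := M.a z f + M.d z f

/-- `b(t₁) ⋯ b(t_m) f` for a list `[t₁, …, t_m]`. -/
def bProd (t : List ℂ) (f : ℂ → W) : ℂ → W := t.foldr M.b f

/-- `f ∈ Fun(W)[μ]`: meromorphic functions with values in the weight space `W[μ]`. -/
def MemFunWeight (μ : ℂ) (f : ℂ → W) : Prop :=
  MeroFun f ∧ ∀ᶠ l in codiscrete ℂ, f l ∈ M.h.eigenspace μ

/-- `W` is a highest weight module of highest weight `(Λ, A, D)` with highest weight vector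
`v₀ ∈ Fun(W)`. -/
structure IsHighestWeight (Λ : ℂ) (A D : ℂ → ℂ → ℂ) (v₀ : ℂ → W) : Prop where
  mem : M.MemFunWeight Λ v₀
  ne_zero : ¬ v₀ =ᶠ[codiscrete ℂ] 0
  c_eq : Dense (interior {x : ℂ × ℂ | M.c x.1 v₀ x.2 = 0})
  a_eq : Dense (interior {x : ℂ × ℂ | M.a x.1 v₀ x.2 = A x.1 x.2 • v₀ x.2})
  d_eq : Dense (interior {x : ℂ × ℂ | M.d x.1 v₀ x.2 = D x.1 x.2 • v₀ x.2})
  /-- `Fun(W)` is spanned by the `b(s₁) ⋯ b(s_r) v₀` over the field of meromorphic functions. -/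
  span : ∀ f : ℂ → W, MeroFun f → ∃ (k : ℕ) (g : Fin k → ℂ → ℂ) (s : Fin k → List ℂ),
    (∀ i, Meromorphic (g i)) ∧ (∀ i, ∀ x ∈ s i, M.IsRegular x) ∧
      f =ᶠ[codiscrete ℂ] fun l => ∑ i, g i l • M.bProd (s i) v₀ l

end EModule

/-! ### Bethe ansatz data -/

section Bethe

variable {n m : ℕ}

/-- `p_j = z_j + η(-Λ_j + 1)`. -/
def pPt (η : ℂ) (z Λs : Fin n → ℂ) (j : Fin n) : ℂ := z j + η * (-Λs j + 1)

/-- `q_j = z_j + η(Λ_j + 1)`. -/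
def qPt (η : ℂ) (z Λs : Fin n → ℂ) (j : Fin n) : ℂ := z j + η * (Λs j + 1)

/-- `D(w,λ) = θ(λ-2ηΛ)/θ(λ) ∏_j θ(w-p_j)/θ(w-q_j)`. -/
def Dfun (τ η Λ : ℂ) (p q : Fin n → ℂ) (w l : ℂ) : ℂ :=
  theta τ (l - 2 * η * Λ) / theta τ l * ∏ j, theta τ (w - p j) / theta τ (w - q j)

/-- `v(λ) = e^{cλ} ∏_{j=1}^m θ(λ-2ηj) v₀(λ)`. -/
def vFun {W : Type*} [AddCommGroup W] [Module ℂ W] (τ η c : ℂ) (m : ℕ) (v₀ : ℂ → W) : ℂ → W :=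
  fun l => (Complex.exp (c * l) * ∏ j ∈ Finset.Icc 1 m, theta τ (l - 2 * η * (j : ℂ))) • v₀ l

/-- The Bethe ansatz equations. All denominators are required to be non-zero. -/
def BetheEqs (τ η c : ℂ) (p q : Fin n → ℂ) (t : Fin m → ℂ) : Prop :=
  (∀ i j, j ≠ i → theta τ (t j - t i + 2 * η) ≠ 0) ∧ (∀ i k, theta τ (t i - p k) ≠ 0) ∧
  ∀ i, (∏ j ∈ Finset.univ.erase i, theta τ (t j - t i - 2 * η) / theta τ (t j - t i + 2 * η)) *
      ∏ k, theta τ (t i - q k) / theta τ (t i - p k) = Complex.exp (4 * η * c)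

/-- The eigenvalue `ε(w)`. -/
def eigval (τ η c : ℂ) (p q : Fin n → ℂ) (t : Fin m → ℂ) (w : ℂ) : ℂ :=
  Complex.exp (-2 * η * c) * ∏ j, theta τ (t j - w - 2 * η) / theta τ (t j - w)
    + Complex.exp (2 * η * c) * (∏ j, theta τ (t j - w + 2 * η) / theta τ (t j - w)) *
      ∏ k, theta τ (w - p k) / theta τ (w - q k)

end Bethe

end EllipticBethe

end

/-! This is the algebraic Bethe ansatz. Three components of the RLL relation say that the b(z)
commute, and that moving a(s) or d(s) to the right past b(t) gives a wanted term, where each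
operator keeps its spectral parameter, plus an unwanted term, where s and t are exchanged
(`ContOn.bb`, `ContOn.ab`, `ContOn.db`). Pulling a(w) and d(w) through b(t_1)...b(t_m) onto v
therefore gives a multiple of ψ plus a combination of the m vectors in which one b(t_i) is replaced
by b(w) (`op_expansion`). The coefficients solve a recursion on the set of factors already passed.
For the unwanted ones the recursion is the three-term theta identity (`theta_three_term`) with e =
±2η.

These coefficients depend on λ. The prefactor e^{cλ}∏θ(λ-2ηj) of v and the condition Λ = 2m are what
make the full product work: the theta quotients in λ then reduce to 1 in both wanted coefficients,
whose sum is ε(w), and to ±θ(λ+t_i-w)/θ(λ) in the unwanted ones. So the unwanted terms of a and d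
differ by a factor free of λ, and their cancellation is exactly the i-th Bethe equation
(`BetheEqs.cancel`).

Values of L at its poles carry no information, so w is kept as a variable and identities are proved
on residual sets of (w,λ) (`eventually_T_eq`). At a regular w both sides are continuous at (w,λ) for
almost all λ, once ε(w) is replaced by its limit, and the identity passes to the limit
(`VCont.eq_of_residual`). The limit exists because the Bethe equations also cancel the apparent
poles of ε at the t_i and, by quasi-periodicity, at their lattice translates, while a pole of the
eigenvalue of d cannot occur at a regular point (`exists_tendsto_eigval_of_theta_eq_zero`,
`IsHighestWeight.exists_tendsto_dEig`).

All facts about zeros and products of θ come from one formula, `theta_mul_theta`, which writes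
θ(x+y)θ(x-y) as a 2×2 determinant. -/

noncomputable section

namespace EllipticBethe

section Theta

/-! ### The theta function -/

/-- The general term of the series for `theta`, without the sign. -/
def thetaTerm (τ t : ℂ) (j : ℤ) : ℂ :=
  Complex.exp (Real.pi * Complex.I * ((j : ℂ) + 1 / 2) ^ 2 * τ
    + 2 * Real.pi * Complex.I * ((j : ℂ) + 1 / 2) * (t + 1 / 2))

lemma thetaTerm_eq (τ t : ℂ) (j : ℤ) :
    thetaTerm τ t j = Complex.exp (Real.pi * Complex.I * (τ / 4 + t + 1 / 2)) *
      jacobiTheta₂_term j (t + 1 / 2 + τ / 2) τ := by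
  rw [thetaTerm, jacobiTheta₂_term, ← Complex.exp_add]
  congr 1; ring

lemma theta_eq (τ t : ℂ) :
    theta τ t = -(Complex.exp (Real.pi * Complex.I * (τ / 4 + t + 1 / 2)) *
      jacobiTheta₂ (t + 1 / 2 + τ / 2) τ) := by
  rw [jacobiTheta₂, ← tsum_mul_left]
  simp only [← thetaTerm_eq]
  rfl

/-- The even part of the degree two theta functions. -/
def thetaEven (τ x : ℂ) : ℂ := jacobiTheta₂ (2 * x) (2 * τ)

/-- The odd part of the degree two theta functions. -/
def thetaOdd (τ x : ℂ) : ℂ :=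
  Complex.exp (Real.pi * Complex.I * (τ / 2 + 2 * x)) * jacobiTheta₂ (2 * x + τ) (2 * τ)

variable {τ : ℂ}

lemma summable_norm_jacobiTheta₂_term (hτ : 0 < τ.im) (z : ℂ) :
    Summable fun n : ℤ => ‖jacobiTheta₂_term n z τ‖ :=
  ((summable_jacobiTheta₂_term_iff z τ).2 hτ).norm

lemma im_two_mul_pos (hτ : 0 < τ.im) : 0 < (2 * τ).im := by
  simpa using hτ

/-- The bijection underlying the product formula for theta functions. -/
def parityMap : (ℤ × ℤ) ⊕ (ℤ × ℤ) → ℤ × ℤ :=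
  Sum.elim (fun p => (p.1 + p.2, p.1 - p.2 - 1)) (fun p => (p.1 + p.2, p.1 - p.2))

/-- The two summands parametrize the pairs (j,k) with j+k odd and with j+k even. -/
lemma parityMap_bijective : Function.Bijective parityMap := by
  constructor
  · rintro (⟨a, b⟩ | ⟨a, b⟩) (⟨c, d⟩ | ⟨c, d⟩) h <;>
      simp only [parityMap, Sum.elim_inl, Sum.elim_inr, Prod.mk.injEq] at h
    · simp only [Sum.inl.injEq, Prod.mk.injEq]; omega
    · omega
    · omega
    · simp only [Sum.inr.injEq, Prod.mk.injEq]; omega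
  · rintro ⟨j, k⟩
    rcases Int.even_or_odd' (j + k) with ⟨a, ha | ha⟩
    · exact ⟨Sum.inr (a, j - a), by simp only [parityMap, Sum.elim_inr, Prod.mk.injEq]; omega⟩
    · exact ⟨Sum.inl (a + 1, j - a - 1), by
        simp only [parityMap, Sum.elim_inl, Prod.mk.injEq]; omega⟩

lemma exp_eq_of_sub_int {x y : ℂ} (n : ℤ) (h : x = y + n * (2 * Real.pi * Complex.I)) :
    Complex.exp x = Complex.exp y :=
  Complex.exp_eq_exp_iff_exists_int.2 ⟨n, h⟩

lemma exp_eq_neg_of_sub_int {x y : ℂ} (n : ℤ)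
    (h : x = y + Real.pi * Complex.I + n * (2 * Real.pi * Complex.I)) :
    Complex.exp x = -Complex.exp y := by
  rw [exp_eq_of_sub_int n h, Complex.exp_add, Complex.exp_pi_mul_I, mul_neg_one]

/-- The product formula `θ(x+y)θ(x-y) = E(x)O(y) - O(x)E(y)`. -/
theorem theta_mul_theta (hτ : 0 < τ.im) (x y : ℂ) :
    theta τ (x + y) * theta τ (x - y) =
      thetaEven τ x * thetaOdd τ y - thetaOdd τ x * thetaEven τ y := by
  have hs : ∀ t, Summable fun j => ‖thetaTerm τ t j‖ := fun t => by
    simp only [thetaTerm_eq, norm_mul]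
    exact (summable_norm_jacobiTheta₂_term hτ _).mul_left _
  set e : ℂ → ℤ → ℂ := fun x a => jacobiTheta₂_term a (2 * x) (2 * τ) with he
  set o : ℂ → ℤ → ℂ := fun x a => Complex.exp (Real.pi * Complex.I * (τ / 2 + 2 * x)) *
    jacobiTheta₂_term a (2 * x + τ) (2 * τ) with ho
  have hes : ∀ x, Summable fun j => ‖e x j‖ := fun x =>
    summable_norm_jacobiTheta₂_term (im_two_mul_pos hτ) _
  have hos : ∀ x, Summable fun j => ‖o x j‖ := fun x => by
    simp only [ho, norm_mul]
    exact (summable_norm_jacobiTheta₂_term (im_two_mul_pos hτ) _).mul_left _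
  have hE : ∀ x, ∑' a, e x a = thetaEven τ x := fun x => rfl
  have hO : ∀ x, ∑' a, o x a = thetaOdd τ x := fun x => by
    rw [thetaOdd, jacobiTheta₂, ← tsum_mul_left]
  have hl : theta τ (x + y) * theta τ (x - y) =
      ∑' p : ℤ × ℤ, thetaTerm τ (x + y) p.1 * thetaTerm τ (x - y) p.2 := by
    rw [← tsum_mul_tsum_of_summable_norm (hs _) (hs _), theta, theta, neg_mul_neg]
    rfl
  have h1 : HasSum (fun p : ℤ × ℤ => e x p.1 * o y p.2) (thetaEven τ x * thetaOdd τ y) := by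
    rw [← hE, ← hO, tsum_mul_tsum_of_summable_norm (hes _) (hos _)]
    exact (summable_mul_of_summable_norm (hes _) (hos _)).hasSum
  have h2 : HasSum (fun p : ℤ × ℤ => -(o x p.1 * e y p.2)) (-(thetaOdd τ x * thetaEven τ y)) := by
    rw [← hE, ← hO, tsum_mul_tsum_of_summable_norm (hos _) (hes _)]
    exact (summable_mul_of_summable_norm (hos _) (hes _)).hasSum.neg
  have h3 : HasSum ((fun p : ℤ × ℤ => thetaTerm τ (x + y) p.1 * thetaTerm τ (x - y) p.2) ∘
      parityMap) (thetaEven τ x * thetaOdd τ y + -(thetaOdd τ x * thetaEven τ y)) := by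
    -- The shifts t+1/2 contribute the phase e^{πi(j+k+1)}: it is 1 on the odd class and -1 on the
    -- even class. This is the origin of the relative sign in the determinant.
    refine HasSum.sum ?_ ?_
    · convert h1 using 1
      ext ⟨a, b⟩
      simp only [Function.comp, parityMap, Sum.elim_inl, thetaTerm, he, ho, jacobiTheta₂_term,
        ← Complex.exp_add]
      refine exp_eq_of_sub_int a ?_
      push_cast; ring
    · convert h2 using 1
      ext ⟨a, b⟩
      simp only [Function.comp, parityMap, Sum.elim_inr, thetaTerm, he, ho, jacobiTheta₂_term,
        ← Complex.exp_add]
      refine exp_eq_neg_of_sub_int a ?_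
      push_cast; ring
  rw [hl, sub_eq_add_neg (_ * _), ← h3.tsum_eq]
  exact ((Equiv.ofBijective _ parityMap_bijective).tsum_eq
    (fun p : ℤ × ℤ => thetaTerm τ (x + y) p.1 * thetaTerm τ (x - y) p.2)).symm

lemma differentiable_jacobiTheta₂ (hτ : 0 < τ.im) : Differentiable ℂ fun z => jacobiTheta₂ z τ :=
  fun z => differentiableAt_jacobiTheta₂_fst z hτ

lemma differentiable_theta (hτ : 0 < τ.im) : Differentiable ℂ (theta τ) := by
  have h : theta τ = fun t => -(Complex.exp (Real.pi * Complex.I * (τ / 4 + t + 1 / 2)) *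
      jacobiTheta₂ (t + 1 / 2 + τ / 2) τ) := funext fun t => theta_eq τ t
  rw [h]
  have := (differentiable_jacobiTheta₂ hτ).comp
    (show Differentiable ℂ fun t : ℂ => t + 1 / 2 + τ / 2 by fun_prop)
  have h2 : Differentiable ℂ fun t : ℂ => Complex.exp (Real.pi * Complex.I * (τ / 4 + t + 1 / 2)) :=
    by fun_prop
  exact (h2.mul this).neg

lemma differentiable_thetaEven (hτ : 0 < τ.im) : Differentiable ℂ (thetaEven τ) :=
  (differentiable_jacobiTheta₂ (im_two_mul_pos hτ)).comp
    (show Differentiable ℂ fun t : ℂ => 2 * t by fun_prop)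

lemma differentiable_thetaOdd (hτ : 0 < τ.im) : Differentiable ℂ (thetaOdd τ) := by
  have := (differentiable_jacobiTheta₂ (im_two_mul_pos hτ)).comp
    (show Differentiable ℂ fun t : ℂ => 2 * t + τ by fun_prop)
  have h2 : Differentiable ℂ fun x : ℂ => Complex.exp (Real.pi * Complex.I * (τ / 2 + 2 * x)) := by
    fun_prop
  exact h2.mul this

lemma continuous_theta (hτ : 0 < τ.im) : Continuous (theta τ) :=
  (differentiable_theta hτ).continuous

lemma theta_add_one (t : ℂ) : theta τ (t + 1) = -theta τ t := by
  rw [theta_eq, theta_eq, show t + 1 + 1 / 2 + τ / 2 = t + 1 / 2 + τ / 2 + 1 by ring,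
    jacobiTheta₂_add_left, exp_eq_neg_of_sub_int (y := Real.pi * Complex.I * (τ / 4 + t + 1 / 2)) 0]
  · ring
  · push_cast; ring

lemma theta_add_tau (t : ℂ) :
    theta τ (t + τ) = -Complex.exp (-(Real.pi * Complex.I * (τ + 2 * t))) * theta τ t := by
  rw [theta_eq, theta_eq, show t + τ + 1 / 2 + τ / 2 = t + 1 / 2 + τ / 2 + τ by ring,
    jacobiTheta₂_add_left', ← mul_assoc, ← Complex.exp_add, neg_mul_neg, ← mul_assoc,
    ← Complex.exp_add, ← neg_mul]
  congr 1
  rw [neg_eq_iff_eq_neg]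
  refine exp_eq_neg_of_sub_int (-1) ?_
  push_cast; ring

lemma theta_neg (t : ℂ) : theta τ (-t) = -theta τ t := by
  have h : jacobiTheta₂ (-t + 1 / 2 + τ / 2) τ = -(Complex.exp (2 * Real.pi * Complex.I * t) *
      jacobiTheta₂ (t + 1 / 2 + τ / 2) τ) := by
    rw [← jacobiTheta₂_neg_left,
      show t + 1 / 2 + τ / 2 = -(-t + 1 / 2 + τ / 2) + 1 + τ by ring, jacobiTheta₂_add_left',
      jacobiTheta₂_add_left, ← mul_assoc, ← Complex.exp_add,
      exp_eq_neg_of_sub_int (y := 0) (-1), Complex.exp_zero]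
    · ring
    · push_cast; ring
  rw [theta_eq, theta_eq, h, mul_neg, ← mul_assoc, ← Complex.exp_add]
  congr 4; ring

lemma theta_zero : theta τ 0 = 0 := by
  have h := theta_neg (τ := τ) 0
  rw [neg_zero] at h
  linear_combination h / 2

/-- The three-term identity for theta functions. -/
theorem theta_three_term (hτ : 0 < τ.im) (l e x y : ℂ) :
    theta τ l * theta τ (x - e) * theta τ (l + e + y) * theta τ (x - y)
      - theta τ (l + x) * theta τ e * theta τ (l + e + y - x) * theta τ y
      = theta τ (l + e) * theta τ (l + y) * theta τ (x - y - e) * theta τ x := by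
  -- The Plücker relation between the 2×2 minors of the columns (E,O) taken at the four points
  -- l+(e+y)/2, (e+y)/2, x-(e+y)/2 and (y-e)/2.
  have h := theta_mul_theta hτ
  have h1 := h (l + (e + y) / 2) ((e + y) / 2)
  have h2 := h (x - (e + y) / 2) ((y - e) / 2)
  have h3 := h (l + (e + y) / 2) (x - (e + y) / 2)
  have h4 := h ((e + y) / 2) ((y - e) / 2)
  have h5 := h (l + (e + y) / 2) ((y - e) / 2)
  have h6 := h ((e + y) / 2) (x - (e + y) / 2)
  have hn := theta_neg (τ := τ) (x - y - e)
  rw [show l + (e + y) / 2 + (e + y) / 2 = l + e + y by ring, add_sub_cancel_right] at h1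
  rw [show x - (e + y) / 2 + (y - e) / 2 = x - e by ring,
    show x - (e + y) / 2 - (y - e) / 2 = x - y by ring] at h2
  rw [show l + (e + y) / 2 + (x - (e + y) / 2) = l + x by ring,
    show l + (e + y) / 2 - (x - (e + y) / 2) = l + e + y - x by ring] at h3
  rw [show (e + y) / 2 + (y - e) / 2 = y by ring, show (e + y) / 2 - (y - e) / 2 = e by ring] at h4
  rw [show l + (e + y) / 2 + (y - e) / 2 = l + y by ring,
    show l + (e + y) / 2 - (y - e) / 2 = l + e by ring] at h5
  rw [show (e + y) / 2 + (x - (e + y) / 2) = x by ring,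
    show (e + y) / 2 - (x - (e + y) / 2) = -(x - y - e) by ring, hn] at h6
  have e1 : theta τ l * theta τ (x - e) * theta τ (l + e + y) * theta τ (x - y) =
    (theta τ (l + e + y) * theta τ l) * (theta τ (x - e) * theta τ (x - y)) := by ring
  have e2 : theta τ (l + x) * theta τ e * theta τ (l + e + y - x) * theta τ y =
    (theta τ (l + x) * theta τ (l + e + y - x)) * (theta τ y * theta τ e) := by ring
  have e3 : theta τ (l + e) * theta τ (l + y) * theta τ (x - y - e) * theta τ x =
    -((theta τ (l + y) * theta τ (l + e)) * (theta τ x * -theta τ (x - y - e))) := by ring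
  rw [e1, e2, e3, h1, h2, h3, h4, h5, h6]
  ring

/-! ### Zeros of the theta function -/

/-- Only the constant Fourier mode survives integration over a period. It serves to show that θ is
not identically zero. -/
lemma integral_jacobiTheta₂ (hτ : 0 < τ.im) (z : ℂ) :
    ∫ x in (0 : ℝ)..1, jacobiTheta₂ (z + x) τ = 1 := by
  have hc : ∀ n : ℤ, Continuous fun x : ℝ => jacobiTheta₂_term n (z + x) τ := fun n => by
    unfold jacobiTheta₂_term; fun_prop
  have h := intervalIntegral.hasSum_intervalIntegral_of_summable_norm (a := 0) (b := 1)
    (f := fun n : ℤ => (⟨fun x : ℝ => jacobiTheta₂_term n (z + x) τ, hc n⟩ : C(ℝ, ℂ))) ?_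
  · have h0 : ∀ n : ℤ, n ≠ 0 → ∫ x in (0 : ℝ)..1, jacobiTheta₂_term n (z + x) τ = 0 := by
      intro n hn
      have hn' : (2 * Real.pi * Complex.I * n : ℂ) ≠ 0 := by
        have := Complex.two_pi_I_ne_zero
        exact mul_ne_zero this (by exact_mod_cast hn)
      have : ∀ x : ℝ, jacobiTheta₂_term n (z + x) τ =
          jacobiTheta₂_term n z τ * Complex.exp ((2 * Real.pi * Complex.I * n) * x) := fun x => by
        simp only [jacobiTheta₂_term, ← Complex.exp_add]
        congr 1; ring
      simp only [this]
      rw [intervalIntegral.integral_const_mul, integral_exp_mul_complex hn']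
      rw [exp_eq_of_sub_int (y := 0) n (by push_cast; ring)]
      simp
    have h1 : ∫ x in (0 : ℝ)..1, jacobiTheta₂_term 0 (z + x) τ = 1 := by
      simp [jacobiTheta₂_term]
    have h2 := hasSum_single (f := fun n : ℤ => ∫ x in (0 : ℝ)..1, jacobiTheta₂_term n (z + x) τ)
      0 (fun n hn => h0 n hn)
    rw [h1] at h2
    exact h.unique h2
  · have hb := summable_pow_mul_jacobiTheta₂_term_bound |z.im| hτ 0
    refine hb.of_nonneg_of_le (fun n => norm_nonneg _) fun n => ?_
    refine (ContinuousMap.norm_le _ (by positivity)).2 fun x => ?_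
    simpa using norm_jacobiTheta₂_term_le (z := z + (x : ℝ)) (S := |z.im|) hτ (by simp) le_rfl n

lemma exists_theta_ne_zero (hτ : 0 < τ.im) : ∃ t, theta τ t ≠ 0 := by
  by_contra! h
  have h0 : ∀ z, jacobiTheta₂ z τ = 0 := fun z => by
    have := h (z - 1 / 2 - τ / 2)
    rw [theta_eq, show z - 1 / 2 - τ / 2 + 1 / 2 + τ / 2 = z by ring] at this
    simpa using this
  simpa [h0] using integral_jacobiTheta₂ hτ 0

lemma eventually_theta_ne_zero (hτ : 0 < τ.im) : ∀ᶠ t in codiscrete ℂ, theta τ t ≠ 0 := by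
  have hd := differentiable_theta hτ
  have ha : AnalyticOnNhd ℂ (theta τ) Set.univ := fun x _ => hd.analyticAt x
  rcases ha.eqOn_zero_or_eventually_ne_zero_of_preconnected isPreconnected_univ with h | h
  · obtain ⟨t, ht⟩ := exists_theta_ne_zero hτ
    exact absurd (h (Set.mem_univ t)) ht
  · exact h

/-- Entire functions with vanishing Wronskian are proportional. -/
lemma exists_eq_const_mul_of_wronskian {f g : ℂ → ℂ} (hf : Differentiable ℂ f)
    (hg : Differentiable ℂ g) (h : ∀ x, deriv f x * g x = f x * deriv g x) {x₀ : ℂ}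
    (hx₀ : g x₀ ≠ 0) : ∃ C, ∀ x, f x = C * g x := by
  obtain ⟨r, hr, hball⟩ := Metric.eventually_nhds_iff_ball.1
    (hg.continuous.continuousAt.eventually_ne hx₀)
  refine ⟨f x₀ / g x₀, fun x => ?_⟩
  have hconst : ∀ y ∈ Metric.ball x₀ r, f y / g y = f x₀ / g x₀ := by
    intro y hy
    refine IsOpen.is_const_of_deriv_eq_zero (𝕜 := ℂ) (f := fun y => f y / g y)
      Metric.isOpen_ball (convex_ball x₀ r).isPreconnected
      (fun z hz => ((hf z).div (hg z) (hball z hz)).differentiableWithinAt) ?_ hy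
      (Metric.mem_ball_self hr)
    intro z hz
    rw [show deriv (fun y => f y / g y) z = _ from deriv_div (hf z) (hg z) (hball z hz), h z]
    simp
  have key : f = fun x => f x₀ / g x₀ * g x := by
    refine AnalyticOnNhd.eq_of_eventuallyEq (𝕜 := ℂ) (z₀ := x₀)
      (fun x _ => hf.analyticAt x) (fun x _ => (hg.const_mul _).analyticAt x) ?_
    filter_upwards [Metric.ball_mem_nhds x₀ hr] with y hy
    rw [← hconst y hy, div_mul_cancel₀ _ (hball y hy)]
  exact congrFun key x

/-- Differentiating the product formula in x at x = y expresses the Wronskian of E and O through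
θ(0) = 0 and θ'(0). If θ'(0) vanished, E and O would be proportional and the product formula at y =
0 would give θ² = 0. -/
lemma deriv_theta_zero_ne_zero (hτ : 0 < τ.im) : deriv (theta τ) 0 ≠ 0 := by
  intro h0
  have hθ := differentiable_theta hτ
  have hE := differentiable_thetaEven hτ
  have hO := differentiable_thetaOdd hτ
  have hw : ∀ y, deriv (thetaOdd τ) y * thetaEven τ y = thetaOdd τ y * deriv (thetaEven τ) y := by
    intro y
    have h1 : HasDerivAt (fun x => theta τ (x + y) * theta τ (x - y))
        (deriv (theta τ) (y + y) * theta τ (y - y) + theta τ (y + y) * deriv (theta τ) (y - y)) y :=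
      ((hθ _).hasDerivAt.comp_add_const _ _).mul ((hθ _).hasDerivAt.comp_sub_const _ _)
    have h2 : HasDerivAt (fun x => theta τ (x + y) * theta τ (x - y))
        (deriv (thetaEven τ) y * thetaOdd τ y - deriv (thetaOdd τ) y * thetaEven τ y) y := by
      simp only [theta_mul_theta hτ]
      exact ((hE y).hasDerivAt.mul_const _).sub ((hO y).hasDerivAt.mul_const _)
    have h3 := h1.unique h2
    rw [sub_self, theta_zero, h0] at h3
    linear_combination h3
  have hz : ∀ x, thetaEven τ x * thetaOdd τ 0 - thetaOdd τ x * thetaEven τ 0 = 0 := by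
    by_cases h : ∃ x₀, thetaEven τ x₀ ≠ 0
    · obtain ⟨x₀, hx₀⟩ := h
      obtain ⟨C, hC⟩ := exists_eq_const_mul_of_wronskian hO hE hw hx₀
      intro x
      rw [hC, hC]; ring
    · push Not at h
      simp [h]
  obtain ⟨t, ht⟩ := exists_theta_ne_zero hτ
  have := theta_mul_theta hτ t 0
  rw [hz, add_zero, sub_zero] at this
  exact ht (mul_self_eq_zero.1 this)

lemma nhdsNE_le_codiscrete (x : ℂ) : 𝓝[≠] x ≤ codiscrete ℂ := fun s hs => by
  simp only [mem_codiscrete, disjoint_principal_right, compl_compl] at hs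
  exact hs x

instance neBot_codiscrete : (codiscrete ℂ).NeBot :=
  NeBot.mono (inferInstance : (𝓝[≠] (0 : ℂ)).NeBot) (nhdsNE_le_codiscrete 0)

lemma codiscrete_map_add (a : ℂ) : Tendsto (fun x => x + a) (codiscrete ℂ) (codiscrete ℂ) := by
  intro s hs
  simp only [mem_codiscrete, mem_map, disjoint_principal_right, compl_compl] at hs ⊢
  intro x
  have h : Tendsto (fun x : ℂ => x + a) (𝓝[≠] x) (𝓝[≠] (x + a)) := by
    refine tendsto_nhdsWithin_iff.2 ⟨?_, ?_⟩
    · exact ((continuous_add_const a).tendsto x).mono_left nhdsWithin_le_nhds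
    · filter_upwards [self_mem_nhdsWithin] with y hy
      simpa using hy
  exact h (hs (x + a))

/-- A zero a of θ makes one determinant vanish, so the vectors (E,O) at (p+q)/2+a and at (p+q)/2 are
parallel. Hence θ(p+a)θ(q+a)/(θ(p)θ(q)) depends on p+q alone. -/
lemma theta_mul_theta_of_zero (hτ : 0 < τ.im) {a : ℂ} (ha : theta τ a = 0) {p q p' q' : ℂ}
    (h : p + q = p' + q') :
    theta τ (p + a) * theta τ (q + a) * (theta τ p' * theta τ q') =
      theta τ (p' + a) * theta τ (q' + a) * (theta τ p * theta τ q) := by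
  have h0 := theta_mul_theta hτ ((p + q) / 2 + a) ((p + q) / 2)
  have h1 := theta_mul_theta hτ ((p + q) / 2 + a) ((p - q) / 2)
  have h2 := theta_mul_theta hτ ((p + q) / 2) ((p' - q') / 2)
  have h3 := theta_mul_theta hτ ((p + q) / 2 + a) ((p' - q') / 2)
  have h4 := theta_mul_theta hτ ((p + q) / 2) ((p - q) / 2)
  rw [show (p + q) / 2 + a - (p + q) / 2 = a by ring, ha, mul_zero] at h0
  rw [show (p + q) / 2 + a + (p - q) / 2 = p + a by ring,
    show (p + q) / 2 + a - (p - q) / 2 = q + a by ring] at h1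
  rw [show (p + q) / 2 + (p' - q') / 2 = p' by rw [h]; ring,
    show (p + q) / 2 - (p' - q') / 2 = q' by rw [h]; ring] at h2
  rw [show (p + q) / 2 + a + (p' - q') / 2 = p' + a by rw [h]; ring,
    show (p + q) / 2 + a - (p' - q') / 2 = q' + a by rw [h]; ring] at h3
  rw [show (p + q) / 2 + (p - q) / 2 = p by ring,
    show (p + q) / 2 - (p - q) / 2 = q by ring] at h4
  rw [h1, h2, h3, h4]
  linear_combination (thetaEven τ ((p - q) / 2) * thetaOdd τ ((p' - q') / 2)
    - thetaOdd τ ((p - q) / 2) * thetaEven τ ((p' - q') / 2)) * (-h0)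

/-- The zeros of `theta` lie in `ℤ + τℤ`. -/
theorem mem_lattice_of_theta_eq_zero (hτ : 0 < τ.im) {a : ℂ} (ha : theta τ a = 0) :
    ∃ r s : ℤ, a = r + s * τ := by
  have hθ := differentiable_theta hτ
  obtain ⟨Q, hQ, hQa⟩ := ((eventually_theta_ne_zero hτ).and
    ((codiscrete_map_add a).eventually (eventually_theta_ne_zero hτ))).exists
  -- With g(P) = θ(P+a)/θ(P), the product g(P+s)g(Q-s) does not depend on s, so g'/g takes the same
  -- value k at P and at Q. It follows that θ(P+a) = C e^{kP} θ(P).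
  set k := deriv (theta τ) (Q + a) / theta τ (Q + a) - deriv (theta τ) Q / theta τ Q with hk
  have hw : ∀ P, deriv (theta τ) (P + a) * theta τ P - theta τ (P + a) * deriv (theta τ) P =
      k * (theta τ (P + a) * theta τ P) := by
    intro P
    have h1 : HasDerivAt (fun s => theta τ (P + a + s) * theta τ (Q + a - s) *
        (theta τ P * theta τ Q))
        ((deriv (theta τ) (P + a) * theta τ (Q + a) - theta τ (P + a) * deriv (theta τ) (Q + a))
          * (theta τ P * theta τ Q)) 0 := by
      have e1 : HasDerivAt (fun s => theta τ (P + a + s)) (deriv (theta τ) (P + a)) 0 := by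
        have := (hθ (P + a + 0)).hasDerivAt.comp_const_add (P + a) 0
        rwa [add_zero] at this
      have e2 : HasDerivAt (fun s => theta τ (Q + a - s)) (-deriv (theta τ) (Q + a)) 0 := by
        have := (hθ (Q + a - 0)).hasDerivAt.comp_const_sub (Q + a) 0
        rwa [sub_zero] at this
      have := (e1.mul e2).mul_const (theta τ P * theta τ Q)
      simpa [sub_eq_add_neg] using this
    have h2 : HasDerivAt (fun s => theta τ (P + a) * theta τ (Q + a) *
        (theta τ (P + s) * theta τ (Q - s)))
        (theta τ (P + a) * theta τ (Q + a) *
          (deriv (theta τ) P * theta τ Q - theta τ P * deriv (theta τ) Q)) 0 := by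
      have e1 : HasDerivAt (fun s => theta τ (P + s)) (deriv (theta τ) P) 0 := by
        have := (hθ (P + 0)).hasDerivAt.comp_const_add P 0
        rwa [add_zero] at this
      have e2 : HasDerivAt (fun s => theta τ (Q - s)) (-deriv (theta τ) Q) 0 := by
        have := (hθ (Q - 0)).hasDerivAt.comp_const_sub Q 0
        rwa [sub_zero] at this
      have := (e1.mul e2).const_mul (theta τ (P + a) * theta τ (Q + a))
      simpa [sub_eq_add_neg] using this
    have h3 : (fun s => theta τ (P + a + s) * theta τ (Q + a - s) * (theta τ P * theta τ Q)) =
        fun s => theta τ (P + a) * theta τ (Q + a) * (theta τ (P + s) * theta τ (Q - s)) := by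
      funext s
      rw [← theta_mul_theta_of_zero hτ ha (p := P + s) (q := Q - s) (p' := P) (q' := Q) (by ring)]
      rw [show P + s + a = P + a + s by ring, show Q - s + a = Q + a - s by ring]
    rw [h3] at h1
    have h4 := h1.unique h2
    rw [hk]
    field_simp
    linear_combination h4
  have hexp : Differentiable ℂ fun p => theta τ (p + a) * Complex.exp (-k * p) := by
    have : Differentiable ℂ fun p => theta τ (p + a) :=
      hθ.comp (show Differentiable ℂ fun p : ℂ => p + a by fun_prop)
    fun_prop
  have hderiv : ∀ p, deriv (fun p => theta τ (p + a) * Complex.exp (-k * p)) p =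
      (deriv (theta τ) (p + a) - k * theta τ (p + a)) * Complex.exp (-k * p) := by
    intro p
    have e2 : HasDerivAt (fun p => Complex.exp (-k * p)) (Complex.exp (-k * p) * (-k)) p := by
      have := ((hasDerivAt_id p).const_mul (-k)).cexp
      simpa using this
    have := (((hθ (p + a)).hasDerivAt.comp_add_const p a).mul e2).deriv
    rw [show deriv (fun p => theta τ (p + a) * Complex.exp (-k * p)) p = _ from this]
    ring
  obtain ⟨C, hC⟩ := exists_eq_const_mul_of_wronskian hexp hθ (fun p => by
    rw [hderiv]
    linear_combination Complex.exp (-k * p) * hw p) hQ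
  -- Comparing multipliers under translation by 1 gives k ∈ 2πiℤ. Under translation by τ they differ
  -- by e^{-2πia}, so 2πia + kτ ∈ 2πiℤ. Together these place a in the lattice.
  have hone : Complex.exp (-k) = 1 := by
    have h1 := hC (Q + 1)
    rw [show Q + 1 + a = Q + a + 1 by ring, theta_add_one, theta_add_one, mul_add, mul_one,
      Complex.exp_add] at h1
    have h2 : theta τ (Q + a) * Complex.exp (-k * Q) * Complex.exp (-k) =
        theta τ (Q + a) * Complex.exp (-k * Q) * 1 := by
      linear_combination -h1 - hC Q
    exact mul_left_cancel₀ (mul_ne_zero hQa (Complex.exp_ne_zero _)) h2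
  have htau : Complex.exp (-(2 * Real.pi * Complex.I * a) - k * τ) = 1 := by
    have h1 := hC (Q + τ)
    rw [show Q + τ + a = Q + a + τ by ring, theta_add_tau, theta_add_tau,
      mul_add (-k), Complex.exp_add,
      show -(Real.pi * Complex.I * (τ + 2 * (Q + a))) =
        -(Real.pi * Complex.I * (τ + 2 * Q)) + -(2 * Real.pi * Complex.I * a) by ring,
      Complex.exp_add] at h1
    have h2 : Complex.exp (-(Real.pi * Complex.I * (τ + 2 * Q))) *
        (theta τ (Q + a) * Complex.exp (-k * Q)) *
        (Complex.exp (-(2 * Real.pi * Complex.I * a)) * Complex.exp (-k * τ)) =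
        Complex.exp (-(Real.pi * Complex.I * (τ + 2 * Q))) *
        (theta τ (Q + a) * Complex.exp (-k * Q)) * 1 := by
      linear_combination -h1 - Complex.exp (-(Real.pi * Complex.I * (τ + 2 * Q))) * hC Q
    have h3 := mul_left_cancel₀ (mul_ne_zero (Complex.exp_ne_zero _)
      (mul_ne_zero hQa (Complex.exp_ne_zero _))) h2
    rw [← Complex.exp_add] at h3
    rw [← h3]; congr 1; ring
  obtain ⟨n, hn⟩ := Complex.exp_eq_one_iff.1 hone
  obtain ⟨l, hl⟩ := Complex.exp_eq_one_iff.1 htau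
  refine ⟨-l, n, ?_⟩
  refine mul_left_cancel₀ Complex.two_pi_I_ne_zero ?_
  push_cast
  linear_combination -hl + τ * hn

/-- Quasi-periodicity of `theta` with respect to the lattice. -/
lemma theta_add_lattice (r s : ℤ) : ∃ C : ℂ, C ≠ 0 ∧
    ∀ t, theta τ (t + (r + s * τ)) = C * Complex.exp (-(2 * Real.pi * Complex.I * s * t)) *
      theta τ t := by
  have hr : ∀ r : ℤ, ∃ C : ℂ, C ≠ 0 ∧ ∀ t, theta τ (t + r) = C * theta τ t := by
    intro r
    induction r using Int.induction_on with
    | zero => exact ⟨1, one_ne_zero, fun t => by simp⟩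
    | succ i ih =>
      obtain ⟨C, hC, h⟩ := ih
      refine ⟨-C, neg_ne_zero.2 hC, fun t => ?_⟩
      push_cast at h ⊢
      rw [← add_assoc, theta_add_one, h]; ring
    | pred i ih =>
      obtain ⟨C, hC, h⟩ := ih
      refine ⟨-C, neg_ne_zero.2 hC, fun t => ?_⟩
      push_cast at h ⊢
      have := theta_add_one (τ := τ) (t + (-i - 1))
      rw [show t + (-(i : ℂ) - 1) + 1 = t + -i by ring, h] at this
      linear_combination this
  have hs : ∀ s : ℤ, ∃ C : ℂ, C ≠ 0 ∧ ∀ t, theta τ (t + s * τ) =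
      C * Complex.exp (-(2 * Real.pi * Complex.I * s * t)) * theta τ t := by
    intro s
    induction s using Int.induction_on with
    | zero => exact ⟨1, one_ne_zero, fun t => by simp⟩
    | succ i ih =>
      obtain ⟨C, hC, h⟩ := ih
      refine ⟨-C * Complex.exp (-(Real.pi * Complex.I * (τ + 2 * (i * τ)))),
        mul_ne_zero (neg_ne_zero.2 hC) (Complex.exp_ne_zero _), fun t => ?_⟩
      push_cast at h ⊢
      rw [show t + ((i : ℂ) + 1) * τ = t + i * τ + τ by ring, theta_add_tau, h,
        show -(2 * Real.pi * Complex.I * ((i : ℂ) + 1) * t) =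
          -(2 * Real.pi * Complex.I * i * t) + -(Real.pi * Complex.I * (2 * t)) by ring,
        show -(Real.pi * Complex.I * (τ + 2 * (t + i * τ))) =
          -(Real.pi * Complex.I * (τ + 2 * (i * τ))) + -(Real.pi * Complex.I * (2 * t)) by ring,
        Complex.exp_add, Complex.exp_add]
      ring
    | pred i ih =>
      obtain ⟨C, hC, h⟩ := ih
      refine ⟨-C * Complex.exp (Real.pi * Complex.I * (τ + 2 * ((-i - 1) * τ))),
        mul_ne_zero (neg_ne_zero.2 hC) (Complex.exp_ne_zero _), fun t => ?_⟩
      push_cast at h ⊢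
      have := theta_add_tau (τ := τ) (t + (-i - 1) * τ)
      rw [show t + (-(i : ℂ) - 1) * τ + τ = t + -i * τ by ring, h] at this
      refine mul_left_cancel₀
        (Complex.exp_ne_zero (-(Real.pi * Complex.I * (τ + 2 * (t + (-i - 1) * τ))))) ?_
      have e : Complex.exp (-(2 * Real.pi * Complex.I * -(i : ℂ) * t)) =
          Complex.exp (-(Real.pi * Complex.I * (τ + 2 * (t + (-i - 1) * τ)))) *
          (Complex.exp (Real.pi * Complex.I * (τ + 2 * ((-i - 1) * τ))) *
          Complex.exp (-(2 * Real.pi * Complex.I * (-(i : ℂ) - 1) * t))) := by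
        rw [← Complex.exp_add, ← Complex.exp_add]; congr 1; ring
      rw [e] at this
      linear_combination this
  obtain ⟨C, hC, h⟩ := hr r
  obtain ⟨C', hC', h'⟩ := hs s
  refine ⟨C * C', mul_ne_zero hC hC', fun t => ?_⟩
  rw [show t + ((r : ℂ) + s * τ) = t + s * τ + r by ring, h, h']
  ring

end Theta

/-! ### Generic points -/

/-- Residual sets are the notion of genericity used in several variables: they are stable under
countable intersections and under preimage by continuous open maps, and they are dense by Baire. -/
lemma residual_le_codiscrete : residual ℂ ≤ codiscrete ℂ := by
  intro s hs
  refine residual_of_dense_open (mem_codiscrete'.1 hs).1 fun x => ?_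
  have : ∃ᶠ y in 𝓝[≠] x, y ∈ s := Eventually.frequently (nhdsNE_le_codiscrete x hs)
  exact mem_closure_iff_frequently.2 (this.filter_mono nhdsWithin_le_nhds)

lemma eventually_residual_of_dense_interior {X : Type*} [TopologicalSpace X] {p : X → Prop}
    (h : Dense (interior {x | p x})) : ∀ᶠ x in residual X, p x :=
  mem_of_superset (residual_of_dense_open isOpen_interior h) interior_subset

lemma eventually_residual_snd {p : ℂ → Prop} (h : ∀ᶠ l in codiscrete ℂ, p l) :
    ∀ᶠ x in residual (ℂ × ℂ), p x.2 :=
  (tendsto_residual_of_isOpenMap continuous_snd isOpenMap_snd).eventually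
    (residual_le_codiscrete h)

lemma eventually_residual_fst {p : ℂ → Prop} (h : ∀ᶠ l in codiscrete ℂ, p l) :
    ∀ᶠ x in residual (ℂ × ℂ), p x.1 :=
  (tendsto_residual_of_isOpenMap continuous_fst isOpenMap_fst).eventually
    (residual_le_codiscrete h)

lemma tendsto_residual_shift (a : ℂ) :
    Tendsto (fun x : ℂ × ℂ => (x.1, x.2 + a)) (residual (ℂ × ℂ)) (residual (ℂ × ℂ)) :=
  let e := (Homeomorph.refl ℂ).prodCongr (Homeomorph.addRight a)
  tendsto_residual_of_isOpenMap e.continuous e.isOpenMap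

/-! ### Continuity of vector-valued functions

A function with values in a vector space without topology is continuous at `x` if near `x` it is a
finite combination of fixed vectors with coefficients continuous at `x`. -/

section VCont

variable {X Y W : Type*} [TopologicalSpace X] [TopologicalSpace Y] [AddCommGroup W] [Module ℂ W]

/-- Near `x` the function `F` is a finite combination of vectors from `U`, with coefficients
continuous at `x`. -/
def VContIn (U : Submodule ℂ W) (F : X → W) (x : X) : Prop :=
  ∃ (ι : Type) (_ : Fintype ι) (f : ι → X → ℂ) (u : ι → W), (∀ i, u i ∈ U) ∧
    (∀ i, ContinuousAt (f i) x) ∧ ∀ᶠ y in 𝓝 x, F y = ∑ i, f i y • u i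

/-- Continuity of a vector-valued function at a point. -/
def VCont (F : X → W) (x : X) : Prop := VContIn ⊤ F x

lemma VCont.mk {F : X → W} {x : X} {ι : Type} [Fintype ι] {f : ι → X → ℂ} {u : ι → W}
    (hf : ∀ i, ContinuousAt (f i) x) (h : ∀ᶠ y in 𝓝 x, F y = ∑ i, f i y • u i) : VCont F x :=
  ⟨ι, inferInstance, f, u, fun _ => Submodule.mem_top, hf, h⟩

lemma VCont.congr {F G : X → W} {x : X} (hF : VCont F x) (h : ∀ᶠ y in 𝓝 x, G y = F y) :
    VCont G x := by
  obtain ⟨ι, _, f, u, _, hf, hFf⟩ := hF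
  exact VCont.mk hf (by filter_upwards [h, hFf] with y h1 h2 using h1.trans h2)

lemma VCont.zero (x : X) : VCont (fun _ => (0 : W)) x :=
  VCont.mk (ι := Empty) (f := fun i => i.elim) (u := fun i => i.elim) (fun i => i.elim) (by simp)

lemma VCont.add {F G : X → W} {x : X} (hF : VCont F x) (hG : VCont G x) :
    VCont (fun y => F y + G y) x := by
  obtain ⟨ι, _, f, u, _, hf, hFf⟩ := hF
  obtain ⟨κ, _, g, v, _, hg, hGg⟩ := hG
  refine VCont.mk (ι := ι ⊕ κ) (f := Sum.elim f g) (u := Sum.elim u v) ?_ ?_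
  · rintro (i | i)
    exacts [hf i, hg i]
  · filter_upwards [hFf, hGg] with y h1 h2
    simp [h1, h2]

lemma VCont.smul {F : X → W} {g : X → ℂ} {x : X} (hg : ContinuousAt g x) (hF : VCont F x) :
    VCont (fun y => g y • F y) x := by
  obtain ⟨ι, _, f, u, _, hf, hFf⟩ := hF
  refine VCont.mk (f := fun i y => g y * f i y) (u := u) (fun i => hg.mul (hf i)) ?_
  filter_upwards [hFf] with y h1
  simp [h1, Finset.smul_sum, mul_smul]

lemma VCont.sum {κ : Type*} (s : Finset κ) {F : κ → X → W} {x : X}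
    (h : ∀ i ∈ s, VCont (F i) x) : VCont (fun y => ∑ i ∈ s, F i y) x := by
  classical
  induction s using Finset.induction_on with
  | empty => simpa using VCont.zero x
  | insert a s ha ih =>
    simp only [Finset.sum_insert ha]
    exact (h a (Finset.mem_insert_self a s)).add
      (ih fun i hi => h i (Finset.mem_insert_of_mem hi))

lemma VCont.comp {F : X → W} {g : Y → X} {y : Y} (hF : VCont F (g y)) (hg : ContinuousAt g y) :
    VCont (fun y => F (g y)) y := by
  obtain ⟨ι, _, f, u, _, hf, hFf⟩ := hF
  exact VCont.mk (f := fun i y => f i (g y)) (u := u) (fun i => (hf i).comp hg)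
    (hg.eventually hFf)

lemma VCont.continuousAt_dual {F : X → W} {x : X} (hF : VCont F x) (φ : Module.Dual ℂ W) :
    ContinuousAt (fun y => φ (F y)) x := by
  obtain ⟨ι, _, f, u, _, hf, hFf⟩ := hF
  have h : ContinuousAt (fun y => ∑ i, f i y * φ (u i)) x :=
    tendsto_finsetSum _ fun i _ => (hf i).mul continuousAt_const
  refine h.congr ?_
  filter_upwards [hFf] with y hy
  simp [hy]

/-- Linear functionals separate the points of W, so uniqueness of limits reduces to scalar functions
and no topology on W is needed. -/
lemma VCont.eq_of_mem_closure {F G : X → W} {x : X} (hF : VCont F x) (hG : VCont G x)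
    {S : Set X} (hS : ∀ y ∈ S, F y = G y) (hx : x ∈ closure S) : F x = G x := by
  rw [← sub_eq_zero, ← Module.forall_dual_apply_eq_zero_iff ℂ]
  intro φ
  rw [map_sub, sub_eq_zero]
  have : (𝓝[S] x).NeBot := mem_closure_iff_nhdsWithin_neBot.1 hx
  refine tendsto_nhds_unique ((hF.continuousAt_dual φ).mono_left (nhdsWithin_le_nhds (s := S)))
    (((hG.continuousAt_dual φ).mono_left (nhdsWithin_le_nhds (s := S))).congr' ?_)
  filter_upwards [self_mem_nhdsWithin] with y hy
  rw [hS y hy]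

lemma VCont.eq_of_residual [BaireSpace X] {F G : X → W} {x : X} (hF : VCont F x) (hG : VCont G x)
    (h : ∀ᶠ y in residual X, F y = G y) : F x = G x :=
  hF.eq_of_mem_closure hG (fun _ hy => hy) (dense_of_mem_residual h x)

/-- A linear projection onto U, applied to the coefficient vectors, does not change F where its
values already lie in U. -/
lemma VCont.vcontIn {F : X → W} {x : X} (hF : VCont F x) {U : Submodule ℂ W}
    (hU : ∀ᶠ y in 𝓝 x, F y ∈ U) : VContIn U F x := by
  obtain ⟨ι, _, f, u, _, hf, hFf⟩ := hF
  obtain ⟨P, hP⟩ := U.subtype.exists_leftInverse_of_injective U.ker_subtype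
  refine ⟨ι, inferInstance, f, fun i => (P (u i) : W), fun i => (P (u i)).2, hf, ?_⟩
  filter_upwards [hFf, hU] with y h1 h2
  have h3 : P (F y) = ⟨F y, h2⟩ := by
    simpa using LinearMap.congr_fun hP ⟨F y, h2⟩
  have h4 : ((P (F y) : U) : W) = F y := by rw [h3]
  rw [← h4, h1]
  simp

/-- Continuity of `y ↦ A y (F y)` for operator-valued `A`. -/
lemma VCont.apply {F : X → W} {A : X → Module.End ℂ W} {x : X} (hF : VCont F x)
    {U : Submodule ℂ W} (hU : ∀ᶠ y in 𝓝 x, F y ∈ U) (hA : ∀ u ∈ U, VCont (fun y => A y u) x) :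
    VCont (fun y => A y (F y)) x := by
  obtain ⟨ι, _, f, u, hu, hf, hFf⟩ := hF.vcontIn hU
  refine VCont.congr (VCont.sum Finset.univ (F := fun i y => f i y • A y (u i))
    fun i _ => VCont.smul (hf i) (hA _ (hu i))) ?_
  filter_upwards [hFf] with y hy
  simp [hy]

lemma VCont.of_basis {A : X → Module.End ℂ W} {x : X} {U : Submodule ℂ W} {κ : Type*}
    [Fintype κ] (e : Module.Basis κ ℂ U) (h : ∀ i, VCont (fun y => A y (e i : W)) x) {u : W}
    (hu : u ∈ U) : VCont (fun y => A y u) x := by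
  have h1 : u = ∑ i, e.repr ⟨u, hu⟩ i • (e i : W) := by
    have := congrArg (Subtype.val) (e.sum_repr ⟨u, hu⟩)
    rw [AddSubmonoidClass.coe_finsetSum] at this
    exact this.symm
  refine VCont.congr (VCont.sum Finset.univ (F := fun i y => e.repr ⟨u, hu⟩ i • A y (e i : W))
    fun i _ => VCont.smul continuousAt_const (h i)) (Eventually.of_forall fun y => ?_)
  conv_lhs => rw [h1]
  simp

end VCont

/-! ### Generic continuity of meromorphic functions. -/

section Mero

variable {W : Type*} [AddCommGroup W] [Module ℂ W]

lemma HolAt.vcont {F : ℂ × ℂ → W} {x : ℂ × ℂ} (h : HolAt F x) : VCont F x := by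
  obtain ⟨k, f, u, hf, h⟩ := h
  exact VCont.mk (fun i => (hf i).continuousAt) h

lemma MeroFun.eventually_vcont {F : ℂ → W} (h : MeroFun F) :
    ∀ᶠ l in codiscrete ℂ, VCont F l := by
  obtain ⟨k, f, u, hf, h⟩ := h
  have h1 : ∀ᶠ l in codiscrete ℂ, ∀ i, AnalyticAt ℂ (f i) l := eventually_all.2 fun i =>
    MeromorphicOn.eventually_codiscreteWithin_analyticAt (f i) fun x _ => hf i x
  filter_upwards [h1] with l hl
  exact VCont.mk (fun i => (hl i).continuousAt) (Eventually.of_forall h)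

/-- Near any point there are points where the local denominator is non-zero, and around those f is a
quotient of analytic functions with non-vanishing denominator. So the continuity set has dense
interior. -/
lemma Meromorphic₂.eventually_continuousAt {f : ℂ × ℂ → ℂ} (hf : Meromorphic₂ f) :
    ∀ᶠ x in residual (ℂ × ℂ), ContinuousAt f x := by
  refine eventually_residual_of_dense_interior fun x => ?_
  obtain ⟨g, h, hg, hh, h0, hfgh⟩ := hf x
  rw [mem_closure_iff_frequently]
  have hfreq : ∃ᶠ y in 𝓝 x, ¬ h y = 0 := not_eventually.1 h0
  refine (hfreq.and_eventually (hg.eventually_analyticAt.eventually_nhds.and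
    (hh.eventually_analyticAt.eventually_nhds.and hfgh.eventually_nhds))).mono ?_
  rintro y ⟨hy0, hgy, hhy, hfy⟩
  have hne : ∀ᶠ y' in 𝓝 y, h y' ≠ 0 := hhy.self_of_nhds.continuousAt.eventually_ne hy0
  rw [mem_interior_iff_mem_nhds]
  filter_upwards [hgy, hhy, hfy.eventually_nhds, hne.eventually_nhds] with y' h1 h2 h3 h4
  refine (h1.continuousAt.div h2.continuousAt h4.self_of_nhds).congr ?_
  filter_upwards [h3, h4] with y'' h5 h6
  exact (h5 h6).symm

lemma MeroFun₂.eventually_vcont {F : ℂ × ℂ → W} (h : MeroFun₂ F) :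
    ∀ᶠ x in residual (ℂ × ℂ), VCont F x := by
  obtain ⟨k, f, u, hf, h⟩ := h
  have h1 : ∀ᶠ l in residual (ℂ × ℂ), ∀ i, ContinuousAt (f i) l := eventually_all.2 fun i =>
    (hf i).eventually_continuousAt
  filter_upwards [h1] with l hl
  exact VCont.mk hl (Eventually.of_forall h)

end Mero

/-! ### Pointwise commutation relations between a, b and d. -/

@[simp] lemma wt_zero : wt 0 = 1 := by simp [wt]

@[simp] lemma wt_one : wt 1 = -1 := by simp [wt]

lemma exists_wt_sub_wt (i j : Fin 2) : ∃ r : ℤ, wt i - wt j = 2 * r := by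
  fin_cases i <;> fin_cases j
  · exact ⟨0, by simp⟩
  · exact ⟨1, by norm_num⟩
  · exact ⟨-1, by norm_num⟩
  · exact ⟨0, by simp⟩

lemma eventually_residual_theta_lam {τ : ℂ} (hτ : 0 < τ.im) (a : ℂ) :
    ∀ᶠ y in residual (ℂ × ℂ × ℂ), theta τ (y.2.2 + a) ≠ 0 := by
  have h1 : IsOpenMap fun y : ℂ × ℂ × ℂ => y.2.2 + a :=
    (Homeomorph.addRight a).isOpenMap.comp (isOpenMap_snd.comp isOpenMap_snd)
  exact (tendsto_residual_of_isOpenMap (by fun_prop) h1).eventually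
    (residual_le_codiscrete (eventually_theta_ne_zero hτ))

lemma eventually_residual_theta_diff {τ : ℂ} (hτ : 0 < τ.im) (a : ℂ) :
    ∀ᶠ y in residual (ℂ × ℂ × ℂ), theta τ (y.1 - y.2.1 - a) ≠ 0 := by
  let A : (ℂ × ℂ × ℂ) →L[ℂ] ℂ := ContinuousLinearMap.fst ℂ ℂ (ℂ × ℂ) -
    (ContinuousLinearMap.fst ℂ ℂ ℂ).comp (ContinuousLinearMap.snd ℂ ℂ (ℂ × ℂ))
  have hA : Function.Surjective A := fun z => ⟨(z, 0, 0), by simp [A]⟩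
  have h1 : IsOpenMap fun y : ℂ × ℂ × ℂ => y.1 - y.2.1 - a :=
    (Homeomorph.subRight a).isOpenMap.comp (A.isOpenMap hA)
  exact (tendsto_residual_of_isOpenMap (by fun_prop) h1).eventually
    (residual_le_codiscrete (eventually_theta_ne_zero hτ))

namespace EModule

variable {τ η : ℂ} {W : Type*} [AddCommGroup W] [Module ℂ W] (M : EModule τ η W)

/-- `L` is continuous at `(z, l + 2ηs)` on the weight spaces of weight `μ + 2r`, for all integers
`r` and `s`. -/
def ContOn (μ z l : ℂ) : Prop :=
  ∀ (r s : ℤ) (i j : Fin 2), ∀ u ∈ M.h.eigenspace (μ + 2 * r),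
    VCont (fun y : ℂ × ℂ => M.L y.1 y.2 i j u) (z, l + 2 * η * s)

/-- Weight spaces are finite-dimensional, so a generic statement for each vector holds generically
for all vectors of a weight at once. -/
lemma eventually_forall_weight {X : Type*} {F : Filter X} {g : X → ℂ × ℂ} (μ : ℂ) (i j : Fin 2)
    (h : ∀ u, ∀ᶠ x in F, VCont (fun y : ℂ × ℂ => M.L y.1 y.2 i j u) (g x)) :
    ∀ᶠ x in F, ∀ u ∈ M.h.eigenspace μ, VCont (fun y : ℂ × ℂ => M.L y.1 y.2 i j u) (g x) := by
  have := M.finite_weight μ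
  have e := Module.finBasis ℂ (M.h.eigenspace μ)
  have h1 : ∀ᶠ x in F, ∀ k, VCont (fun y : ℂ × ℂ => M.L y.1 y.2 i j (e k : W)) (g x) :=
    eventually_all.2 fun k => h _
  filter_upwards [h1] with x hx u hu
  exact VCont.of_basis (A := fun y : ℂ × ℂ => M.L y.1 y.2 i j) e hx hu

/-- A curve of spectral parameters along which `L` is generically continuous. -/
def Good (s : ℂ → ℂ) : Prop :=
  ∀ i j u, ∀ᶠ x in residual (ℂ × ℂ), VCont (fun y : ℂ × ℂ => M.L y.1 y.2 i j u) (s x.1, x.2)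

/-- Only two kinds of curves are used: the identity, for the variable w of the transfer matrix, and
constants at regular points, for the Bethe roots. -/
lemma good_id : M.Good id := fun i j u => (M.L_mero i j u).eventually_vcont

variable {M}

lemma IsRegular.good {z : ℂ} (hz : M.IsRegular z) : M.Good fun _ => z := fun i j u =>
  eventually_residual_snd (p := fun l => VCont (fun y : ℂ × ℂ => M.L y.1 y.2 i j u) (z, l))
    ((hz i j u).2.mono fun _ h => h.vcont)

/-- All integer weight shifts r and dynamical shifts s are imposed simultaneously. There are
countably many conditions, so the result is still residual. -/
lemma Good.eventually_contOn {s : ℂ → ℂ} (hs : M.Good s) (μ : ℂ) :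
    ∀ᶠ x in residual (ℂ × ℂ), M.ContOn μ (s x.1) x.2 := by
  unfold ContOn
  simp only [eventually_countable_forall]
  intro r k i j
  have h := (tendsto_residual_shift (2 * η * k)).eventually
    (M.eventually_forall_weight (g := fun x => (s x.1, x.2)) (μ + 2 * r) i j fun u => hs i j u)
  exact h

/-- Both sides of the RLL relation are combinations of such composites. The inner operator changes
the weight by an even integer, which is why `ContOn` ranges over the weights μ + 2r. -/
lemma ContOn.vcont_comp {μ z₀ w₀ l₀ : ℂ} (hz : M.ContOn μ z₀ l₀) (hw : M.ContOn μ w₀ l₀)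
    {y₀ : ℂ × ℂ × ℂ} {ζ ω : ℂ × ℂ × ℂ → ℂ} (hζ : Continuous ζ) (hω : Continuous ω)
    (hζ₀ : ζ y₀ = z₀) (hω₀ : ω y₀ = w₀) (hy₀ : y₀.2.2 = l₀) (s s' : ℤ) (k i l j : Fin 2) {u : W}
    (hu : u ∈ M.h.eigenspace μ) :
    VCont (fun y : ℂ × ℂ × ℂ => M.L (ζ y) (y.2.2 + 2 * η * s) k i
      (M.L (ω y) (y.2.2 + 2 * η * s') l j u)) y₀ := by
  obtain ⟨r, hr⟩ := exists_wt_sub_wt j l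
  refine VCont.apply (A := fun y : ℂ × ℂ × ℂ => M.L (ζ y) (y.2.2 + 2 * η * s) k i)
    (F := fun y : ℂ × ℂ × ℂ => M.L (ω y) (y.2.2 + 2 * η * s') l j u)
    (U := M.h.eigenspace (μ + 2 * r)) ?_ ?_ ?_
  · have h0 := hw 0 s' l j u (by simpa using hu)
    refine VCont.comp (F := fun y : ℂ × ℂ => M.L y.1 y.2 l j u)
      (g := fun y : ℂ × ℂ × ℂ => (ω y, y.2.2 + 2 * η * s')) ?_ (by fun_prop)
    simpa only [hω₀, hy₀] using h0
  · refine Eventually.of_forall fun y => ?_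
    have := M.L_weight (ω y) (y.2.2 + 2 * η * s') l j μ u hu
    rwa [add_sub_assoc, hr] at this
  · intro v hv
    refine VCont.comp (F := fun y : ℂ × ℂ => M.L y.1 y.2 k i v)
      (g := fun y : ℂ × ℂ × ℂ => (ζ y, y.2.2 + 2 * η * s)) ?_ (by fun_prop)
    simpa only [hζ₀, hy₀] using hz r s k i v hv

lemma eventually_RLL (M : EModule τ η W) (i j i' j' : Fin 2) (μ : ℂ) {u : W}
    (hu : u ∈ M.h.eigenspace μ) : ∀ᶠ y in residual (ℂ × ℂ × ℂ),
      ∑ k, ∑ l, R τ η (y.1 - y.2.1) (y.2.2 - 2 * η * (μ + wt i + wt j - wt k - wt l))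
          (i', j') (k, l) • M.L y.1 y.2.2 k i (M.L y.2.1 (y.2.2 - 2 * η * wt i) l j u)
        = ∑ k, ∑ l, R τ η (y.1 - y.2.1) y.2.2 (k, l) (i, j) •
          M.L y.2.1 y.2.2 j' l (M.L y.1 (y.2.2 - 2 * η * wt l) i' k u) := by
  filter_upwards [eventually_residual_of_dense_interior (M.RLL i j i' j' μ u hu)] with y hy
  exact hy y.1 y.2.1 y.2.2 rfl

/-- `b(z)` and `b(w)` commute. -/
lemma ContOn.bb {μ z w l : ℂ} (hz : M.ContOn μ z l) (hw : M.ContOn μ w l) {u : W}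
    (hu : u ∈ M.h.eigenspace μ) :
    M.L z l 0 1 (M.L w (l + 2 * η) 0 1 u) = M.L w l 0 1 (M.L z (l + 2 * η) 0 1 u) := by
  have h1 := hz.vcont_comp hw (y₀ := (z, w, l)) (ζ := fun y => y.1) (ω := fun y => y.2.1)
    (by fun_prop) (by fun_prop) rfl rfl rfl 0 1 0 1 0 1 hu
  have h2 := hw.vcont_comp hz (y₀ := (z, w, l)) (ζ := fun y => y.2.1) (ω := fun y => y.1)
    (by fun_prop) (by fun_prop) rfl rfl rfl 0 1 0 1 0 1 hu
  have := h1.eq_of_residual h2 ?_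
  · simpa using this
  -- In the component from e[-1] ⊗ e[-1] to e[1] ⊗ e[1], the only non-zero R-matrix entries on
  -- either side equal 1.
  filter_upwards [eventually_RLL M 1 1 0 0 μ hu] with y hy
  simpa [R, E, Matrix.single_apply, Fin.sum_univ_two] using hy

/-- Clearing denominators in α and β, with the signs from -l absorbed by oddness of θ. -/
lemma alpha_mul {z l : ℂ} (hl : theta τ l ≠ 0) (hz : theta τ (z - 2 * η) ≠ 0) :
    theta τ l * theta τ (z - 2 * η) * alpha τ η z (-l) = theta τ (l - 2 * η) * theta τ z := by
  rw [alpha, show -l + 2 * η = -(l - 2 * η) by ring, theta_neg, theta_neg]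
  field_simp

lemma beta_mul {z l : ℂ} (hl : theta τ l ≠ 0) (hz : theta τ (z - 2 * η) ≠ 0) :
    theta τ l * theta τ (z - 2 * η) * beta τ η z l = -(theta τ (l + z) * theta τ (2 * η)) := by
  rw [beta]
  field_simp

lemma beta_neg_mul {z l : ℂ} (hl : theta τ l ≠ 0) (hz : theta τ (z - 2 * η) ≠ 0) :
    theta τ l * theta τ (z - 2 * η) * beta τ η z (-l) =
      -(theta τ (l - z) * theta τ (2 * η)) := by
  rw [beta, show -l + z = -(l - z) by ring, theta_neg, theta_neg]
  field_simp

/-- The commutation relation between `a(s)` and `b(t)`. -/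
lemma ContOn.ab (hτ : 0 < τ.im) {μ s t l : ℂ} (hs : M.ContOn μ s l) (ht : M.ContOn μ t l) {u : W}
    (hu : u ∈ M.h.eigenspace μ) :
    (theta τ (l - 2 * η) * theta τ (t - s)) • M.L s l 0 0 (M.L t (l - 2 * η) 0 1 u) =
      (theta τ l * theta τ (t - s - 2 * η)) • M.L t l 0 1 (M.L s (l + 2 * η) 0 0 u) +
      (theta τ (l + (t - s)) * theta τ (2 * η)) • M.L s l 0 1 (M.L t (l + 2 * η) 0 0 u) := by
  have hθ := continuous_theta hτ
  have h1 := hs.vcont_comp ht (y₀ := (t, s, l)) (ζ := fun y => y.2.1) (ω := fun y => y.1)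
    (by fun_prop) (by fun_prop) rfl rfl rfl 0 (-1) 0 0 0 1 hu
  have h2 := ht.vcont_comp hs (y₀ := (t, s, l)) (ζ := fun y => y.1) (ω := fun y => y.2.1)
    (by fun_prop) (by fun_prop) rfl rfl rfl 0 1 0 1 0 0 hu
  have h3 := hs.vcont_comp ht (y₀ := (t, s, l)) (ζ := fun y => y.2.1) (ω := fun y => y.1)
    (by fun_prop) (by fun_prop) rfl rfl rfl 0 1 0 1 0 0 hu
  -- Multiplied by θ(λ)θ(t-s-2η), the relation has continuous coefficients, so it extends to points
  -- where these denominators vanish.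
  have := (h1.smul (g := fun y => theta τ (y.2.2 - 2 * η) * theta τ (y.1 - y.2.1))
    (by fun_prop)).eq_of_residual
    ((h2.smul (g := fun y => theta τ y.2.2 * theta τ (y.1 - y.2.1 - 2 * η)) (by fun_prop)).add
    (h3.smul (g := fun y => theta τ (y.2.2 + (y.1 - y.2.1)) * theta τ (2 * η)) (by fun_prop))) ?_
  · simpa [sub_eq_add_neg] using this
  filter_upwards [eventually_RLL M 1 0 0 0 μ hu, eventually_residual_theta_lam hτ 0,
    eventually_residual_theta_diff hτ (2 * η)] with y hy hl hd
  rw [add_zero] at hl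
  simp [R, E, Matrix.single_apply, Fin.sum_univ_two] at hy
  have e1 := alpha_mul hl hd
  have e2 := beta_mul hl hd
  simp only [Int.cast_zero, mul_zero, add_zero, Int.cast_one, mul_one, Int.cast_neg, mul_neg,
    ← sub_eq_add_neg, hy, smul_add, smul_smul, e1, e2]
  module

/-- The commutation relation between `d(s)` and `b(t)`. -/
lemma ContOn.db (hτ : 0 < τ.im) {μ s t l : ℂ} (hs : M.ContOn μ s l) (ht : M.ContOn μ t l) {u : W}
    (hu : u ∈ M.h.eigenspace μ) {ν : ℂ} (hν : ν = l - 2 * η * (μ - 2)) :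
    (theta τ (ν - 2 * η) * theta τ (t - s)) • M.L s l 1 1 (M.L t (l + 2 * η) 0 1 u) =
      (theta τ ν * theta τ (t - s + 2 * η)) • M.L t l 0 1 (M.L s (l + 2 * η) 1 1 u) -
      (theta τ (ν + (t - s)) * theta τ (2 * η)) • M.L s l 0 1 (M.L t (l + 2 * η) 1 1 u) := by
  have hθ := continuous_theta hτ
  have h1 := hs.vcont_comp ht (y₀ := (s, t, l)) (ζ := fun y => y.1) (ω := fun y => y.2.1)
    (by fun_prop) (by fun_prop) rfl rfl rfl 0 1 1 1 0 1 hu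
  have h2 := ht.vcont_comp hs (y₀ := (s, t, l)) (ζ := fun y => y.2.1) (ω := fun y => y.1)
    (by fun_prop) (by fun_prop) rfl rfl rfl 0 1 0 1 1 1 hu
  have h3 := hs.vcont_comp ht (y₀ := (s, t, l)) (ζ := fun y => y.1) (ω := fun y => y.2.1)
    (by fun_prop) (by fun_prop) rfl rfl rfl 0 1 0 1 1 1 hu
  have := (h1.smul (g := fun y => theta τ (y.2.2 - 2 * η * (μ - 2) - 2 * η) *
      theta τ (y.1 - y.2.1)) (by fun_prop)).eq_of_residual
    ((h2.smul (g := fun y => theta τ (y.2.2 - 2 * η * (μ - 2)) * theta τ (y.1 - y.2.1 - 2 * η))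
      (by fun_prop)).add
    (h3.smul (g := fun y => theta τ (y.2.2 - 2 * η * (μ - 2) - (y.1 - y.2.1)) *
      theta τ (2 * η)) (by fun_prop))) ?_
  · simp only [Int.cast_zero, mul_zero, add_zero, Int.cast_one, mul_one, ← hν] at this
    rw [show t - s = -(s - t) by ring, show -(s - t) + 2 * η = -(s - t - 2 * η) by ring, theta_neg,
      theta_neg, mul_neg, mul_neg, neg_smul, this, ← sub_eq_add_neg]
    module
  -- Here the nontrivial R-matrix entries stand on the left and carry the shift by h⁽³⁾. The
  -- resulting vector has weight μ - 2, whence the argument ν = λ - 2η(μ-2).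
  filter_upwards [eventually_RLL M 1 1 1 0 μ hu, eventually_residual_theta_lam hτ
    (-(2 * η * (μ - 2))), eventually_residual_theta_diff hτ (2 * η)] with y hy hl hd
  rw [← sub_eq_add_neg] at hl
  simp [R, E, Matrix.single_apply, Fin.sum_univ_two] at hy
  have e1 := alpha_mul hl hd
  have e2 := beta_neg_mul hl hd
  rw [show 2 * η * (μ + -1 + -1) - y.2.2 = -(y.2.2 - 2 * η * (μ - 2)) by ring,
    show 2 * η * (μ + -1 - 1) - y.2.2 = -(y.2.2 - 2 * η * (μ - 2)) by ring] at hy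
  simp only [Int.cast_zero, mul_zero, add_zero, Int.cast_one, mul_one, ← hy, smul_add, smul_smul,
    e1, e2]
  module

end EModule

/-! ### Operators on functions of (w,λ) and the expansion of a product of b's. -/

namespace EModule

variable {τ η : ℂ} {W : Type*} [AddCommGroup W] [Module ℂ W] (M : EModule τ η W)

/-- The entries of `L̃`, with spectral parameter `s(w)`, acting on functions of `(w, λ)`. -/
def op (i j : Fin 2) (s : ℂ → ℂ) (F : ℂ × ℂ → W) : ℂ × ℂ → W :=
  fun x => M.L (s x.1) x.2 i j (F (x.1, x.2 - 2 * η * wt j))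

/-- Functions of `(w, λ)` whose generic values have weight `μ`. -/
def GenWeight (μ : ℂ) (F : ℂ × ℂ → W) : Prop :=
  ∀ᶠ x in residual (ℂ × ℂ), F x ∈ M.h.eigenspace μ

variable {M}

lemma eventually_shift {p : ℂ × ℂ → Prop} (h : ∀ᶠ x in residual (ℂ × ℂ), p x) (a : ℂ) :
    ∀ᶠ x in residual (ℂ × ℂ), p (x.1, x.2 - a) := by
  simpa only [sub_eq_add_neg] using (tendsto_residual_shift (-a)).eventually h

lemma op_congr {i j : Fin 2} {s : ℂ → ℂ} {F G : ℂ × ℂ → W} (h : F =ᶠ[residual (ℂ × ℂ)] G) :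
    M.op i j s F =ᶠ[residual (ℂ × ℂ)] M.op i j s G := by
  filter_upwards [eventually_shift h (2 * η * wt j)] with x hx
  simp only [op, hx]

variable {μ : ℂ} {F : ℂ × ℂ → W} {s t : ℂ → ℂ}

lemma Good.op_bb (hs : M.Good s) (ht : M.Good t) (hF : M.GenWeight μ F) :
    M.op 0 1 s (M.op 0 1 t F) =ᶠ[residual (ℂ × ℂ)] M.op 0 1 t (M.op 0 1 s F) := by
  filter_upwards [hs.eventually_contOn μ, ht.eventually_contOn μ,
    eventually_shift hF (2 * η * wt 1 + 2 * η * wt 1)] with x h1 h2 h3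
  simpa [op, sub_add_eq_sub_sub] using h1.bb h2 h3

lemma Good.op_ab (hτ : 0 < τ.im) (hs : M.Good s) (ht : M.Good t) (hF : M.GenWeight μ F) :
    ∀ᶠ x in residual (ℂ × ℂ),
      (theta τ (x.2 - 2 * η) * theta τ (t x.1 - s x.1)) • M.op 0 0 s (M.op 0 1 t F) x =
      (theta τ x.2 * theta τ (t x.1 - s x.1 - 2 * η)) • M.op 0 1 t (M.op 0 0 s F) x +
      (theta τ (x.2 + (t x.1 - s x.1)) * theta τ (2 * η)) • M.op 0 1 s (M.op 0 0 t F) x := by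
  filter_upwards [hs.eventually_contOn μ, ht.eventually_contOn μ, hF] with x h1 h2 h3
  simpa [op] using h1.ab hτ h2 h3

lemma Good.op_db (hτ : 0 < τ.im) (hs : M.Good s) (ht : M.Good t) (hF : M.GenWeight μ F)
    {a : ℂ} (ha : a = 2 * η * (μ - 2)) :
    ∀ᶠ x in residual (ℂ × ℂ),
      (theta τ (x.2 - a - 2 * η) * theta τ (t x.1 - s x.1)) • M.op 1 1 s (M.op 0 1 t F) x =
      (theta τ (x.2 - a) * theta τ (t x.1 - s x.1 + 2 * η)) • M.op 0 1 t (M.op 1 1 s F) x -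
      (theta τ (x.2 - a + (t x.1 - s x.1)) * theta τ (2 * η)) • M.op 0 1 s (M.op 1 1 t F) x := by
  filter_upwards [hs.eventually_contOn μ, ht.eventually_contOn μ,
    eventually_shift hF (2 * η * wt 1 + 2 * η * wt 1)] with x h1 h2 h3
  simpa [op, sub_add_eq_sub_sub] using h1.db hτ h2 h3 (ν := x.2 - a) (by rw [ha])

/-- Commuting `L̃_{jj}(s)` through a product of operators `b(t_i)`: the coefficients are determined
by the recursion `hstep`. -/
theorem op_expansion {ι : Type*} [DecidableEq ι] (t : ι → ℂ) (ht : ∀ i, M.Good fun _ => t i)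
    (B : Finset ι → ℂ × ℂ → W) (wB : Finset ι → ℂ) (hwB : ∀ S, M.GenWeight (wB S) (B S))
    (hB : ∀ i S, i ∉ S → B (insert i S) =ᶠ[residual (ℂ × ℂ)] M.op 0 1 (fun _ => t i) (B S))
    (j : Fin 2) (C₀ : (ℂ → ℂ) → Finset ι → ℂ × ℂ → ℂ)
    (C₁ : (ℂ → ℂ) → ι → Finset ι → ℂ × ℂ → ℂ) (Ad : (ℂ → ℂ) → Finset ι → Prop)
    (hAd_good : ∀ s S, Ad s S → M.Good s)
    (hAd_mono : ∀ s i S, Ad s (insert i S) → Ad s S)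
    (hAd_const : ∀ i S, i ∉ S → Ad (fun _ => t i) S)
    (h0 : ∀ s, Ad s ∅ → ∀ᶠ x in residual (ℂ × ℂ), M.op j j s (B ∅) x = C₀ s ∅ x • B ∅ x)
    (hstep : ∀ s i S, i ∉ S → Ad s (insert i S) → ∃ p q : ℂ × ℂ → ℂ,
      (∀ᶠ x in residual (ℂ × ℂ), M.op j j s (M.op 0 1 (fun _ => t i) (B S)) x =
        p x • M.op 0 1 (fun _ => t i) (M.op j j s (B S)) x +
        q x • M.op 0 1 s (M.op j j (fun _ => t i) (B S)) x) ∧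
      (∀ᶠ x in residual (ℂ × ℂ), C₀ s (insert i S) x = p x * C₀ s S (x.1, x.2 + 2 * η)) ∧
      (∀ᶠ x in residual (ℂ × ℂ),
        C₁ s i (insert i S) x = q x * C₀ (fun _ => t i) S (x.1, x.2 + 2 * η)) ∧
      ∀ i' ∈ S, ∀ᶠ x in residual (ℂ × ℂ), C₁ s i' (insert i S) x =
        p x * C₁ s i' S (x.1, x.2 + 2 * η) +
        q x * C₁ (fun _ => t i) i' S (x.1, x.2 + 2 * η))
    (S : Finset ι) : ∀ s, Ad s S → ∀ᶠ x in residual (ℂ × ℂ), M.op j j s (B S) x =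
      C₀ s S x • B S x + ∑ i ∈ S, C₁ s i S x • M.op 0 1 s (B (S.erase i)) x := by
  induction S using Finset.induction_on with
  | empty => simpa using h0
  | insert i S hi ih =>
    -- The induction hypothesis is needed for two curves, s and the constant t i, because the
    -- unwanted term of a single exchange leaves the operator at t i to be moved past the remaining
    -- factors.
    intro s hs
    obtain ⟨p, q, hpq, hC0, hC1, hC1'⟩ := hstep s i S hi hs
    have hgood := hAd_good s _ hs
    -- An outer b evaluates its argument at λ + 2η, which shifts the coefficients from the induction
    -- hypothesis.
    have key : ∀ s' r : ℂ → ℂ, Ad s' S → ∀ᶠ x in residual (ℂ × ℂ),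
        M.op 0 1 r (M.op j j s' (B S)) x =
          C₀ s' S (x.1, x.2 + 2 * η) • M.op 0 1 r (B S) x +
          ∑ i' ∈ S, C₁ s' i' S (x.1, x.2 + 2 * η) •
            M.op 0 1 r (M.op 0 1 s' (B (S.erase i'))) x := by
      intro s' r hs'
      filter_upwards [eventually_shift (ih s' hs') (2 * η * wt 1)] with x hx
      simp only [op] at hx ⊢
      rw [hx]
      simp
    -- Both exchanges lead to the same vector: b(s) times the product over `insert i S` without i'.
    -- For one of them this uses that b(s) and b(t i) commute.
    have hcomm : ∀ᶠ x in residual (ℂ × ℂ), ∀ i' ∈ S,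
        M.op 0 1 s (M.op 0 1 (fun _ => t i) (B (S.erase i'))) x =
          M.op 0 1 s (B ((insert i S).erase i')) x ∧
        M.op 0 1 (fun _ => t i) (M.op 0 1 s (B (S.erase i'))) x =
          M.op 0 1 s (B ((insert i S).erase i')) x := by
      refine (Finset.eventually_all S).2 fun i' hi' => ?_
      have hne : i ≠ i' := fun h => hi (h ▸ hi')
      have h1 := hB i (S.erase i') fun h => hi (Finset.mem_of_mem_erase h)
      rw [← Finset.erase_insert_of_ne hne] at h1
      filter_upwards [op_congr (M := M) (i := 0) (j := 1) (s := s) h1,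
        (ht i).op_bb hgood (hwB (S.erase i'))] with x e1 e2
      exact ⟨e1.symm, e2.trans e1.symm⟩
    filter_upwards [op_congr (M := M) (i := j) (j := j) (s := s) (hB i S hi), hB i S hi, hpq, hC0,
      hC1, (Finset.eventually_all S).2 hC1', key s (fun _ => t i) (hAd_mono _ _ _ hs),
      key (fun _ => t i) s (hAd_const i S hi), hcomm] with x e1 e2 e3 e4 e5 e6 e7 e8 e9
    rw [e1, e3, e7, e8, e2, Finset.sum_insert hi, Finset.erase_insert hi, e4, e5]
    have e10 : ∑ i' ∈ S, C₁ s i' (insert i S) x • M.op 0 1 s (B ((insert i S).erase i')) x =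
        p x • ∑ i' ∈ S, C₁ s i' S (x.1, x.2 + 2 * η) •
            M.op 0 1 (fun _ => t i) (M.op 0 1 s (B (S.erase i'))) x +
        q x • ∑ i' ∈ S, C₁ (fun _ => t i) i' S (x.1, x.2 + 2 * η) •
            M.op 0 1 s (M.op 0 1 (fun _ => t i) (B (S.erase i'))) x := by
      rw [Finset.smul_sum, Finset.smul_sum, ← Finset.sum_add_distrib]
      refine Finset.sum_congr rfl fun i' hi' => ?_
      rw [e6 i' hi', (e9 i' hi').1, (e9 i' hi').2, add_smul, mul_smul, mul_smul]
    rw [e10]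
    module

end EModule

/-! ### Bethe vectors as weight-valued meromorphic functions. -/

section Mero

variable {W : Type*} [AddCommGroup W] [Module ℂ W]

lemma MeroFun.of_fintype {F : ℂ → W} {ι : Type*} [Fintype ι] {f : ι → ℂ → ℂ} {u : ι → W}
    (hf : ∀ i, Meromorphic (f i)) (h : ∀ x, F x = ∑ i, f i x • u i) : MeroFun F := by
  let e := Fintype.equivFin ι
  refine ⟨Fintype.card ι, fun i => f (e.symm i), fun i => u (e.symm i), fun i => hf _, fun x => ?_⟩
  rw [h, ← e.symm.sum_comp]

lemma meromorphic_comp_sub {f : ℂ → ℂ} (hf : Meromorphic f) (a : ℂ) :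
    Meromorphic fun x => f (x - a) := fun x => by
  have h : AnalyticAt ℂ (fun x : ℂ => x - a) x := by fun_prop
  exact MeromorphicAt.comp_analyticAt (g := fun x : ℂ => x - a) (hf (x - a)) h

lemma MeroFun.smul {F : ℂ → W} (hF : MeroFun F) {g : ℂ → ℂ} (hg : Meromorphic g) :
    MeroFun fun x => g x • F x := by
  obtain ⟨k, f, u, hf, h⟩ := hF
  refine ⟨k, fun i x => g x * f i x, u, fun i x => (hg x).mul (hf i x), fun x => ?_⟩
  simp [h, Finset.smul_sum, mul_smul]

end Mero

lemma eventually_codiscrete_nhds {p : ℂ → Prop} (h : ∀ᶠ l in codiscrete ℂ, p l) :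
    ∀ᶠ l in codiscrete ℂ, ∀ᶠ y in 𝓝 l, p y := by
  have ho := (mem_codiscrete'.1 h).1
  filter_upwards [h] with l hl
  exact ho.mem_nhds hl

lemma eventually_codiscrete_sub {p : ℂ → Prop} (h : ∀ᶠ l in codiscrete ℂ, p l) (a : ℂ) :
    ∀ᶠ l in codiscrete ℂ, p (l - a) := by
  simpa only [sub_eq_add_neg] using (codiscrete_map_add (-a)).eventually h

namespace EModule

variable {τ η : ℂ} {W : Type*} [AddCommGroup W] [Module ℂ W] {M : EModule τ η W}

lemma IsRegular.meroFun_entry {z : ℂ} (hz : M.IsRegular z) {f : ℂ → W} (hf : MeroFun f)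
    (i j : Fin 2) : MeroFun (M.entry i j z f) := by
  obtain ⟨k, g, u, hg, h⟩ := hf
  choose n q v hq hv using fun a => (hz i j (u a)).1
  replace hv : ∀ a x, M.L z x i j (u a) = ∑ b, q a b x • v a b := hv
  refine MeroFun.of_fintype (ι := Σ a, Fin (n a))
    (f := fun b x => g b.1 (x - 2 * η * wt j) * q b.1 b.2 x) (u := fun b => v b.1 b.2)
    (fun b x => (meromorphic_comp_sub (hg b.1) _ x).mul (hq _ _ x)) fun x => ?_
  rw [entry, h, map_sum, Fintype.sum_sigma]
  refine Finset.sum_congr rfl fun a _ => ?_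
  rw [map_smul, hv, Finset.smul_sum]
  simp only [mul_smul]

lemma MemFunWeight.entry {z : ℂ} (hz : M.IsRegular z) {μ : ℂ} {f : ℂ → W}
    (hf : M.MemFunWeight μ f) (i j : Fin 2) :
    M.MemFunWeight (μ + wt j - wt i) (M.entry i j z f) := by
  refine ⟨hz.meroFun_entry hf.1 i j, ?_⟩
  filter_upwards [eventually_codiscrete_sub hf.2 (2 * η * wt j)] with l hl
  exact M.L_weight _ _ _ _ _ _ hl

lemma MemFunWeight.bProd {μ : ℂ} {f : ℂ → W} (hf : M.MemFunWeight μ f) :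
    ∀ l : List ℂ, (∀ z ∈ l, M.IsRegular z) → M.MemFunWeight (μ - 2 * l.length) (M.bProd l f)
  | [], _ => by simpa [EModule.bProd] using hf
  | z :: l, h => by
    have h1 := MemFunWeight.entry (h z (by simp))
      (MemFunWeight.bProd hf l fun y hy => h y (by simp [hy])) 0 1
    have e : μ - 2 * ((z :: l).length : ℂ) = μ - 2 * l.length + wt 1 - wt 0 := by
      simp; ring
    rw [e]
    exact h1

lemma MemFunWeight.genWeight {μ : ℂ} {f : ℂ → W} (hf : M.MemFunWeight μ f) :
    M.GenWeight μ fun x => f x.2 := eventually_residual_snd hf.2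

/-- Commutativity of the b's makes the order irrelevant up to a generic identity, so the products
can be indexed by finite sets. -/
lemma bProd_perm {μ : ℂ} {f : ℂ → W} (hf : M.MemFunWeight μ f) {l l' : List ℂ} (h : l.Perm l')
    (hl : ∀ z ∈ l, M.IsRegular z) :
    (fun x : ℂ × ℂ => M.bProd l f x.2) =ᶠ[residual (ℂ × ℂ)] fun x => M.bProd l' f x.2 := by
  induction h with
  | nil => rfl
  | cons z _ ih =>
    exact op_congr (M := M) (i := 0) (j := 1) (s := fun _ => z) (ih fun y hy => hl y (by simp [hy]))
  | swap y z l =>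
    exact (hl z (by simp)).good.op_bb (s := fun _ => z) (t := fun _ => y) (hl y (by simp)).good
      (hf.bProd l fun x hx => hl x (by simp [hx])).genWeight
  | trans h1 _ ih1 ih2 => exact (ih1 hl).trans (ih2 fun z hz => hl z (h1.mem_iff.2 hz))

/-- `L̃(z)f` is jointly continuous at `(z, l)` for almost all `l` if `z` is regular. -/
lemma IsRegular.eventually_vcont_entry {z : ℂ} (hz : M.IsRegular z) {μ : ℂ} {f : ℂ → W}
    (hf : M.MemFunWeight μ f) (i j : Fin 2) : ∀ᶠ l in codiscrete ℂ,
      VCont (fun y : ℂ × ℂ => M.entry i j y.1 f y.2) (z, l) := by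
  filter_upwards [M.eventually_forall_weight (g := fun l => (z, l)) μ i j
      fun u => (hz i j u).2.mono fun _ h => h.vcont,
    eventually_codiscrete_sub hf.1.eventually_vcont (2 * η * wt j),
    eventually_codiscrete_sub (eventually_codiscrete_nhds hf.2) (2 * η * wt j)] with l h1 h2 h3
  have hc : ContinuousAt (fun y : ℂ × ℂ => y.2 - 2 * η * wt j) (z, l) := by fun_prop
  exact VCont.apply (A := fun y : ℂ × ℂ => M.L y.1 y.2 i j) (U := M.h.eigenspace μ)
    (F := fun y : ℂ × ℂ => f (y.2 - 2 * η * wt j)) (VCont.comp h2 hc) (hc.eventually h3) h1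

lemma eventually_vcont_snd {f : ℂ → W} (hf : MeroFun f) (z : ℂ) : ∀ᶠ l in codiscrete ℂ,
    VCont (fun y : ℂ × ℂ => f y.2) (z, l) := by
  filter_upwards [hf.eventually_vcont] with l hl
  exact VCont.comp (g := fun y : ℂ × ℂ => y.2) hl (by fun_prop)

end EModule

/-! ### The coefficients in the Bethe ansatz -/

/-- The scalar factor of `vFun`. -/
def vCoeff (τ η c : ℂ) (m : ℕ) (l : ℂ) : ℂ :=
  Complex.exp (c * l) * ∏ j ∈ Finset.Icc 1 m, theta τ (l - 2 * η * (j : ℂ))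

/-- The product telescopes under λ ↦ λ - 2η: only the two end factors change. This is how the
prefactor of v corrects the λ-dependence of the eigenvalues. -/
lemma theta_prod_shift (τ η : ℂ) (m : ℕ) (l : ℂ) :
    theta τ (l - 2 * η) * ∏ j ∈ Finset.Icc 1 m, theta τ (l - 2 * η - 2 * η * (j : ℂ)) =
      theta τ (l - 2 * η * (m + 1)) * ∏ j ∈ Finset.Icc 1 m, theta τ (l - 2 * η * (j : ℂ)) := by
  induction m with
  | zero => simp
  | succ m ih =>
    rw [Finset.prod_Icc_succ_top (by omega), Finset.prod_Icc_succ_top (by omega), ← mul_assoc, ih]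
    push_cast
    rw [show l - 2 * η - 2 * η * ((m : ℂ) + 1) = l - 2 * η * (m + 1 + 1) by ring]
    ring

lemma vCoeff_sub {τ : ℂ} (η c : ℂ) (m : ℕ) {l : ℂ} (h : theta τ (l - 2 * η) ≠ 0) :
    vCoeff τ η c m (l - 2 * η) = Complex.exp (-2 * η * c) *
      (theta τ (l - 2 * η * (m + 1)) / theta τ (l - 2 * η)) * vCoeff τ η c m l := by
  rw [vCoeff, vCoeff, show c * (l - 2 * η) = -2 * η * c + c * l by ring, Complex.exp_add]
  field_simp
  linear_combination theta_prod_shift τ η m l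

lemma vCoeff_add {τ : ℂ} (η c : ℂ) (m : ℕ) {l : ℂ} (h : theta τ (l - 2 * η * m) ≠ 0) :
    vCoeff τ η c m (l + 2 * η) = Complex.exp (2 * η * c) *
      (theta τ l / theta τ (l - 2 * η * m)) * vCoeff τ η c m l := by
  have h1 := theta_prod_shift τ η m (l + 2 * η)
  rw [show l + 2 * η - 2 * η = l by ring,
    show l + 2 * η - 2 * η * ((m : ℂ) + 1) = l - 2 * η * m by ring] at h1
  rw [vCoeff, vCoeff, show c * (l + 2 * η) = 2 * η * c + c * l by ring, Complex.exp_add]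
  field_simp
  linear_combination -h1

lemma meromorphic_vCoeff {τ : ℂ} (hτ : 0 < τ.im) (η c : ℂ) (m : ℕ) :
    Meromorphic (vCoeff τ η c m) := by
  have hθ := differentiable_theta hτ
  have h : Differentiable ℂ (vCoeff τ η c m) := by
    unfold vCoeff
    refine Differentiable.mul (by fun_prop) (Differentiable.fun_finsetProd fun j _ => ?_)
    exact hθ.comp (show Differentiable ℂ fun l : ℂ => l - 2 * η * (j : ℂ) by fun_prop)
  exact fun x => (h.analyticAt x).meromorphicAt

section Coeff

variable {m n : ℕ} (τ η c : ℂ) (p q : Fin n → ℂ) (t : Fin m → ℂ)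

/-- The wanted coefficient for `a`. -/
def aWanted (s : ℂ → ℂ) (S : Finset (Fin m)) (x : ℂ × ℂ) : ℂ :=
  Complex.exp (-2 * η * c) * theta τ (x.2 + 2 * η * (S.card - m - 1)) / theta τ (x.2 - 2 * η) *
    ∏ j ∈ S, theta τ (t j - s x.1 - 2 * η) / theta τ (t j - s x.1)

/-- The unwanted coefficients for `a`. -/
def aUnwanted (s : ℂ → ℂ) (i : Fin m) (S : Finset (Fin m)) (x : ℂ × ℂ) : ℂ :=
  Complex.exp (-2 * η * c) * theta τ (x.2 + 2 * η * (S.card - m - 1)) / theta τ (x.2 - 2 * η) *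
    (theta τ (x.2 + (t i - s x.1)) * theta τ (2 * η) / (theta τ (t i - s x.1) * theta τ x.2)) *
    ∏ j ∈ S.erase i, theta τ (t j - t i - 2 * η) / theta τ (t j - t i)

/-- The `λ`-independent part of the eigenvalue of `d`. -/
def dEig (w : ℂ) : ℂ := ∏ k, theta τ (w - p k) / theta τ (w - q k)

/-- The wanted coefficient for `d`. -/
def dWanted (s : ℂ → ℂ) (S : Finset (Fin m)) (x : ℂ × ℂ) : ℂ :=
  Complex.exp (2 * η * c) * dEig τ p q (s x.1) *
    (theta τ (x.2 - 4 * η * (m - S.card)) / theta τ (x.2 - 2 * η * (m - S.card))) *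
    ∏ j ∈ S, theta τ (t j - s x.1 + 2 * η) / theta τ (t j - s x.1)

/-- The unwanted coefficients for `d`. -/
def dUnwanted (s : ℂ → ℂ) (i : Fin m) (S : Finset (Fin m)) (x : ℂ × ℂ) : ℂ :=
  -(Complex.exp (2 * η * c) * dEig τ p q (t i) / theta τ (x.2 - 2 * η * (m - S.card))) *
    (theta τ (x.2 - 4 * η * (m - S.card) + (t i - s x.1)) * theta τ (2 * η) /
      theta τ (t i - s x.1)) *
    ∏ j ∈ S.erase i, theta τ (t j - t i + 2 * η) / theta τ (t j - t i)

variable {τ η c p q t}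

lemma aWanted_insert {s : ℂ → ℂ} {i : Fin m} {S : Finset (Fin m)} (hi : i ∉ S) {x : ℂ × ℂ}
    (h0 : theta τ x.2 ≠ 0) :
    aWanted τ η c t s (insert i S) x =
      theta τ x.2 * theta τ (t i - s x.1 - 2 * η) / (theta τ (x.2 - 2 * η) * theta τ (t i - s x.1))
        * aWanted τ η c t s S (x.1, x.2 + 2 * η) := by
  simp only [aWanted, Finset.prod_insert hi, Finset.card_insert_of_notMem hi, Nat.cast_add,
    Nat.cast_one]
  rw [show x.2 + 2 * η * ((S.card : ℂ) + 1 - m - 1) =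
      x.2 + 2 * η + 2 * η * (S.card - m - 1) by ring,
    add_sub_cancel_right]
  field_simp

lemma aUnwanted_insert_self {s : ℂ → ℂ} {i : Fin m} {S : Finset (Fin m)} (hi : i ∉ S) {x : ℂ × ℂ} :
    aUnwanted τ η c t s i (insert i S) x =
      theta τ (x.2 + (t i - s x.1)) * theta τ (2 * η) / (theta τ (x.2 - 2 * η) *
        theta τ (t i - s x.1)) * aWanted τ η c t (fun _ => t i) S (x.1, x.2 + 2 * η) := by
  simp only [aWanted, aUnwanted, Finset.erase_insert hi, Finset.card_insert_of_notMem hi,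
    Nat.cast_add, Nat.cast_one]
  rw [show x.2 + 2 * η * ((S.card : ℂ) + 1 - m - 1) =
      x.2 + 2 * η + 2 * η * (S.card - m - 1) by ring,
    add_sub_cancel_right]
  field_simp

/-- The b(t i') that gets replaced may be exchanged directly with s, or via t i. The two
contributions add up by the three-term identity with e = 2η, x = t i - s and y = t i' - s. -/
lemma aUnwanted_insert (hτ : 0 < τ.im) {s : ℂ → ℂ} {i i' : Fin m} {S : Finset (Fin m)} (hi : i ∉ S)
    (hi' : i' ∈ S) {x : ℂ × ℂ} (h0 : theta τ x.2 ≠ 0) (hm : theta τ (x.2 - 2 * η) ≠ 0)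
    (hp : theta τ (x.2 + 2 * η) ≠ 0) (hX : theta τ (t i - s x.1) ≠ 0)
    (hY : theta τ (t i' - s x.1) ≠ 0) (hD : theta τ (t i - t i') ≠ 0) :
    aUnwanted τ η c t s i' (insert i S) x =
      theta τ x.2 * theta τ (t i - s x.1 - 2 * η) / (theta τ (x.2 - 2 * η) * theta τ (t i - s x.1))
        * aUnwanted τ η c t s i' S (x.1, x.2 + 2 * η) +
      theta τ (x.2 + (t i - s x.1)) * theta τ (2 * η) / (theta τ (x.2 - 2 * η) *
        theta τ (t i - s x.1)) * aUnwanted τ η c t (fun _ => t i) i' S (x.1, x.2 + 2 * η) := by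
  have hne : i ≠ i' := fun h => hi (h ▸ hi')
  have key := theta_three_term hτ x.2 (2 * η) (t i - s x.1) (t i' - s x.1)
  rw [show t i - s x.1 - (t i' - s x.1) = t i - t i' by ring,
    show x.2 + 2 * η + (t i' - s x.1) - (t i - s x.1) = x.2 + 2 * η + (t i' - t i) by ring] at key
  simp only [aUnwanted, Finset.card_insert_of_notMem hi, Finset.erase_insert_of_ne hne,
    Finset.prod_insert (fun h => hi (Finset.mem_of_mem_erase h) : i ∉ S.erase i'),
    Nat.cast_add, Nat.cast_one]
  rw [show x.2 + 2 * η * ((S.card : ℂ) + 1 - m - 1) =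
      x.2 + 2 * η + 2 * η * (S.card - m - 1) by ring,
    add_sub_cancel_right, show t i' - t i = -(t i - t i') by ring, theta_neg]
  rw [show t i' - t i = -(t i - t i') by ring] at key
  generalize ∏ j ∈ S.erase i', theta τ (t j - t i' - 2 * η) / theta τ (t j - t i') = G
  generalize theta τ (x.2 + 2 * η + 2 * η * (S.card - m - 1)) = N
  field_simp
  linear_combination (-(N * theta τ (2 * η) * G)) * key

lemma dWanted_insert {s : ℂ → ℂ} {i : Fin m} {S : Finset (Fin m)} (hi : i ∉ S) {x : ℂ × ℂ} {ν : ℂ}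
    (hν : ν = x.2 - 4 * η * (m - (S.card + 1))) (h0 : theta τ (ν - 2 * η) ≠ 0) :
    dWanted τ η c p q t s (insert i S) x =
      theta τ ν * theta τ (t i - s x.1 + 2 * η) / (theta τ (ν - 2 * η) * theta τ (t i - s x.1))
        * dWanted τ η c p q t s S (x.1, x.2 + 2 * η) := by
  simp only [dWanted, Finset.prod_insert hi, Finset.card_insert_of_notMem hi, Nat.cast_add,
    Nat.cast_one]
  rw [← hν, show x.2 + 2 * η - 4 * η * ((m : ℂ) - S.card) = ν - 2 * η by rw [hν]; ring,
    show x.2 + 2 * η - 2 * η * ((m : ℂ) - S.card) = x.2 - 2 * η * (m - (S.card + 1)) by ring]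
  field_simp

lemma dUnwanted_insert_self {s : ℂ → ℂ} {i : Fin m} {S : Finset (Fin m)} (hi : i ∉ S)
    {x : ℂ × ℂ} {ν : ℂ} (hν : ν = x.2 - 4 * η * (m - (S.card + 1)))
    (h0 : theta τ (ν - 2 * η) ≠ 0) :
    dUnwanted τ η c p q t s i (insert i S) x =
      -(theta τ (ν + (t i - s x.1)) * theta τ (2 * η)) / (theta τ (ν - 2 * η) *
        theta τ (t i - s x.1)) * dWanted τ η c p q t (fun _ => t i) S (x.1, x.2 + 2 * η) := by
  simp only [dWanted, dUnwanted, Finset.erase_insert hi, Finset.card_insert_of_notMem hi,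
    Nat.cast_add, Nat.cast_one]
  rw [← hν, show x.2 + 2 * η - 4 * η * ((m : ℂ) - S.card) = ν - 2 * η by rw [hν]; ring,
    show x.2 + 2 * η - 2 * η * ((m : ℂ) - S.card) = x.2 - 2 * η * (m - (S.card + 1)) by ring]
  field_simp

/-- The same three-term identity with e = -2η, and with the shifted dynamical variable ν in place of
λ. -/
lemma dUnwanted_insert (hτ : 0 < τ.im) {s : ℂ → ℂ} {i i' : Fin m} {S : Finset (Fin m)} (hi : i ∉ S)
    (hi' : i' ∈ S) {x : ℂ × ℂ} {ν : ℂ} (hν : ν = x.2 - 4 * η * (m - (S.card + 1)))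
    (hm : theta τ (ν - 2 * η) ≠ 0) (hX : theta τ (t i - s x.1) ≠ 0)
    (hY : theta τ (t i' - s x.1) ≠ 0) (hD : theta τ (t i - t i') ≠ 0) :
    dUnwanted τ η c p q t s i' (insert i S) x =
      theta τ ν * theta τ (t i - s x.1 + 2 * η) / (theta τ (ν - 2 * η) * theta τ (t i - s x.1))
        * dUnwanted τ η c p q t s i' S (x.1, x.2 + 2 * η) +
      -(theta τ (ν + (t i - s x.1)) * theta τ (2 * η)) / (theta τ (ν - 2 * η) *
        theta τ (t i - s x.1)) * dUnwanted τ η c p q t (fun _ => t i) i' S (x.1, x.2 + 2 * η) := by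
  have hne : i ≠ i' := fun h => hi (h ▸ hi')
  have key := theta_three_term hτ ν (-(2 * η)) (t i - s x.1) (t i' - s x.1)
  rw [theta_neg, show t i - s x.1 - (t i' - s x.1) = t i - t i' by ring,
    show ν + -(2 * η) + (t i' - s x.1) - (t i - s x.1) = ν - 2 * η + (t i' - t i) by ring,
    sub_neg_eq_add, sub_neg_eq_add, ← sub_eq_add_neg] at key
  simp only [dUnwanted, Finset.card_insert_of_notMem hi, Finset.erase_insert_of_ne hne,
    Finset.prod_insert (fun h => hi (Finset.mem_of_mem_erase h) : i ∉ S.erase i'),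
    Nat.cast_add, Nat.cast_one]
  rw [← hν, show x.2 + 2 * η - 4 * η * ((m : ℂ) - S.card) = ν - 2 * η by rw [hν]; ring,
    show x.2 + 2 * η - 2 * η * ((m : ℂ) - S.card) = x.2 - 2 * η * (m - (S.card + 1)) by ring,
    show t i' - t i = -(t i - t i') by ring, theta_neg]
  rw [show t i' - t i = -(t i - t i') by ring] at key
  generalize ∏ j ∈ S.erase i', theta τ (t j - t i' + 2 * η) / theta τ (t j - t i') = G
  generalize Complex.exp (2 * η * c) * dEig τ p q (t i') /
    theta τ (x.2 - 2 * η * (m - (S.card + 1))) = N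
  field_simp
  linear_combination (N * theta τ (2 * η) * G) * key

end Coeff

lemma eventually_theta_sub_ne_zero {τ : ℂ} (hτ : 0 < τ.im) (a : ℂ) :
    ∀ᶠ l in codiscrete ℂ, theta τ (l - a) ≠ 0 :=
  eventually_codiscrete_sub (eventually_theta_ne_zero hτ) a

lemma continuousAt_dEig {τ : ℂ} (hτ : 0 < τ.im) {n : ℕ} (p : Fin n → ℂ) {q : Fin n → ℂ} {w : ℂ}
    (hq : ∀ k, theta τ (w - q k) ≠ 0) : ContinuousAt (dEig τ p q) w := by
  have hθ := continuous_theta hτ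
  unfold dEig
  exact tendsto_finsetProd _ fun k _ =>
    ContinuousAt.div (f := fun w => theta τ (w - p k)) (g := fun w => theta τ (w - q k))
      (by fun_prop) (by fun_prop) (hq k)

/-! ### Expansion of a and d on the products of b's applied to v. -/

namespace EModule

variable {τ η Λ : ℂ} {W : Type*} [AddCommGroup W] [Module ℂ W] {M : EModule τ η W} {n m : ℕ}
  {p q : Fin n → ℂ} {v₀ : ℂ → W}

/-- The highest weight relation is given only generically in (z,λ). Joint continuity at a regular z
carries it to that fixed z, in particular to the Bethe roots. -/
lemma IsHighestWeight.a_eq_of_isRegular {D : ℂ → ℂ → ℂ}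
    (hW : M.IsHighestWeight Λ (fun _ _ => 1) D v₀) {z : ℂ} (hz : M.IsRegular z) :
    ∀ᶠ l in codiscrete ℂ, M.entry 0 0 z v₀ l = v₀ l := by
  filter_upwards [hz.eventually_vcont_entry hW.mem 0 0, eventually_vcont_snd hW.mem.1 z]
    with l h1 h2
  refine h1.eq_of_residual h2 ?_
  filter_upwards [eventually_residual_of_dense_interior hW.a_eq] with x hx
  rw [one_smul] at hx
  exact hx

lemma IsHighestWeight.d_eq_of_isRegular (hτ : 0 < τ.im)
    (hW : M.IsHighestWeight Λ (fun _ _ => 1) (Dfun τ η Λ p q) v₀) {z : ℂ} (hz : M.IsRegular z)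
    (hq : ∀ k, theta τ (z - q k) ≠ 0) :
    ∀ᶠ l in codiscrete ℂ, M.entry 1 1 z v₀ l = Dfun τ η Λ p q z l • v₀ l := by
  have hθ := continuous_theta hτ
  filter_upwards [hz.eventually_vcont_entry hW.mem 1 1, eventually_vcont_snd hW.mem.1 z,
    eventually_theta_ne_zero hτ] with l h1 h2 h3
  have hc : ContinuousAt (fun y : ℂ × ℂ => Dfun τ η Λ p q y.1 y.2) (z, l) := by
    have e1 : ContinuousAt (fun y : ℂ × ℂ => dEig τ p q y.1) (z, l) :=
      ContinuousAt.comp (x := (z, l)) (g := dEig τ p q) (f := Prod.fst)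
        (continuousAt_dEig hτ p hq) continuousAt_fst
    have e2 : ContinuousAt (fun y : ℂ × ℂ => theta τ (y.2 - 2 * η * Λ) / theta τ y.2) (z, l) :=
      ContinuousAt.div (by fun_prop) (by fun_prop) h3
    exact e2.mul e1
  refine h1.eq_of_residual (h2.smul hc) ?_
  exact eventually_residual_of_dense_interior hW.d_eq

variable (M p q v₀ Λ) in
/-- Spectral parameters `s(w)` to which the Bethe ansatz computation applies: `L` is generically
continuous, `v₀` is an eigenvector of `a(s)` and `d(s)`, and `s` avoids the points `t i`. -/
structure Admissible (t : Fin m → ℂ) (s : ℂ → ℂ) (S : Finset (Fin m)) : Prop where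
  good : M.Good s
  a_eq : ∀ᶠ x in residual (ℂ × ℂ), M.op 0 0 s (fun y => v₀ y.2) x = v₀ x.2
  d_eq : ∀ᶠ x in residual (ℂ × ℂ), M.op 1 1 s (fun y => v₀ y.2) x =
    Dfun τ η Λ p q (s x.1) x.2 • v₀ x.2
  theta_ne : ∀ i ∈ S, ∀ᶠ x in residual (ℂ × ℂ), theta τ (t i - s x.1) ≠ 0

lemma admissible_id (hτ : 0 < τ.im)
    (hW : M.IsHighestWeight Λ (fun _ _ => 1) (Dfun τ η Λ p q) v₀) (t : Fin m → ℂ)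
    (S : Finset (Fin m)) : M.Admissible Λ p q v₀ t id S where
  good := M.good_id
  a_eq := by
    filter_upwards [eventually_residual_of_dense_interior hW.a_eq] with x hx
    rw [one_smul] at hx
    exact hx
  d_eq := eventually_residual_of_dense_interior hW.d_eq
  theta_ne i _ := by
    filter_upwards [eventually_residual_fst (eventually_theta_sub_ne_zero hτ (t i))] with x hx
    rw [show t i - id x.1 = -(x.1 - t i) by simp, theta_neg]
    exact neg_ne_zero.2 hx

lemma admissible_const (hτ : 0 < τ.im)
    (hW : M.IsHighestWeight Λ (fun _ _ => 1) (Dfun τ η Λ p q) v₀) {t : Fin m → ℂ} {z : ℂ}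
    (hz : M.IsRegular z) (hq : ∀ k, theta τ (z - q k) ≠ 0) {S : Finset (Fin m)}
    (hS : ∀ i ∈ S, theta τ (t i - z) ≠ 0) : M.Admissible Λ p q v₀ t (fun _ => z) S where
  good := hz.good
  a_eq := eventually_residual_snd (hW.a_eq_of_isRegular hz)
  d_eq := eventually_residual_snd (p := fun l => M.entry 1 1 z v₀ l = Dfun τ η Λ p q z l • v₀ l)
    (hW.d_eq_of_isRegular hτ hz hq)
  theta_ne i hi := Eventually.of_forall fun _ => hS i hi

lemma Admissible.mono {t : Fin m → ℂ} {s : ℂ → ℂ} {S S' : Finset (Fin m)}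
    (h : M.Admissible Λ p q v₀ t s S') (hS : S ⊆ S') : M.Admissible Λ p q v₀ t s S :=
  ⟨h.good, h.a_eq, h.d_eq, fun i hi => h.theta_ne i (hS hi)⟩

lemma memFunWeight_vFun (hτ : 0 < τ.im) (c : ℂ) (hv₀ : M.MemFunWeight Λ v₀) :
    M.MemFunWeight Λ (vFun τ η c m v₀) := by
  refine ⟨hv₀.1.smul (meromorphic_vCoeff hτ η c m), ?_⟩
  filter_upwards [hv₀.2] with l hl
  exact Submodule.smul_mem _ _ hl

variable (M) in
/-- The product of the operators `b(t i)`, `i ∈ S`, applied to `v`. -/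
def bVec (t : Fin m → ℂ) (v : ℂ → W) (S : Finset (Fin m)) : ℂ × ℂ → W :=
  fun x => M.bProd (S.toList.map t) v x.2

lemma bVec_insert {t : Fin m → ℂ} (ht : ∀ i, M.IsRegular (t i)) {v : ℂ → W}
    (hv : M.MemFunWeight Λ v) (i : Fin m) (S : Finset (Fin m)) (hi : i ∉ S) :
    M.bVec t v (insert i S) =ᶠ[residual (ℂ × ℂ)] M.op 0 1 (fun _ => t i) (M.bVec t v S) := by
  refine bProd_perm (l' := t i :: S.toList.map t) hv ((Finset.toList_insert hi).map t) ?_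
  intro z hz
  obtain ⟨j, _, rfl⟩ := List.mem_map.1 hz
  exact ht j

lemma genWeight_bVec {t : Fin m → ℂ} (ht : ∀ i, M.IsRegular (t i)) {v : ℂ → W}
    (hv : M.MemFunWeight Λ v) (S : Finset (Fin m)) :
    M.GenWeight (Λ - 2 * S.card) (M.bVec t v S) := by
  have h := (hv.bProd (S.toList.map t) fun z hz => by
    obtain ⟨j, _, rfl⟩ := List.mem_map.1 hz
    exact ht j).genWeight
  rw [List.length_map, Finset.length_toList] at h
  exact h

/-- The action of `a(s)` on a product of operators `b(t i)` applied to `v`. -/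
lemma a_expansion (hτ : 0 < τ.im)
    (hW : M.IsHighestWeight Λ (fun _ _ => 1) (Dfun τ η Λ p q) v₀)
    {t : Fin m → ℂ} (ht : ∀ i, M.IsRegular (t i))
    (ht_ne : ∀ i j, i ≠ j → theta τ (t i - t j) ≠ 0)
    (htq : ∀ i k, theta τ (t i - q k) ≠ 0) (c : ℂ)
    (S : Finset (Fin m)) (s : ℂ → ℂ) (hs : M.Admissible Λ p q v₀ t s S) :
    ∀ᶠ x in residual (ℂ × ℂ), M.op 0 0 s (M.bVec t (vFun τ η c m v₀) S) x =
      aWanted τ η c t s S x • M.bVec t (vFun τ η c m v₀) S x +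
      ∑ i ∈ S, aUnwanted τ η c t s i S x •
        M.op 0 1 s (M.bVec t (vFun τ η c m v₀) (S.erase i)) x := by
  have hv := memFunWeight_vFun (m := m) hτ c hW.mem
  have hl : ∀ a, ∀ᶠ x in residual (ℂ × ℂ), theta τ (x.2 - a) ≠ 0 := fun a =>
    eventually_residual_snd (eventually_theta_sub_ne_zero hτ a)
  refine op_expansion t (fun i => (ht i).good) _ (fun S => Λ - 2 * S.card)
    (genWeight_bVec ht hv) (bVec_insert ht hv) 0 _ _ (M.Admissible Λ p q v₀ t)
    (fun _ _ h => h.good) (fun _ _ _ h => h.mono (Finset.subset_insert _ _))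
    (fun i S hi => admissible_const hτ hW (ht i) (htq i) fun j hj =>
      ht_ne j i fun h => hi (h ▸ hj)) ?_ ?_ S s hs
  · intro s hs
    filter_upwards [hs.a_eq, hl (2 * η)] with x h1 h2
    have e : M.op 0 0 s (M.bVec t (vFun τ η c m v₀) ∅) x =
        vCoeff τ η c m (x.2 - 2 * η) • M.op 0 0 s (fun y => v₀ y.2) x := by
      simp [op, bVec, EModule.bProd, vFun, vCoeff]
    rw [e, h1, vCoeff_sub η c m h2]
    simp only [aWanted, bVec, EModule.bProd, vFun, Finset.toList_empty, List.map_nil,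
      List.foldr_nil, Finset.prod_empty, Finset.card_empty, smul_smul]
    rw [show x.2 + 2 * η * (((0 : ℕ) : ℂ) - m - 1) = x.2 - 2 * η * (m + 1) by push_cast; ring]
    congr 1
    rw [vCoeff]
    ring
  · intro s i S hi hs
    refine ⟨fun x => theta τ x.2 * theta τ (t i - s x.1 - 2 * η) /
        (theta τ (x.2 - 2 * η) * theta τ (t i - s x.1)),
      fun x => theta τ (x.2 + (t i - s x.1)) * theta τ (2 * η) /
        (theta τ (x.2 - 2 * η) * theta τ (t i - s x.1)), ?_, ?_, ?_, ?_⟩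
    · filter_upwards [hs.good.op_ab hτ (ht i).good (genWeight_bVec ht hv S), hl (2 * η),
        hs.theta_ne i (Finset.mem_insert_self i S)] with x h1 h2 h3
      have h4 := mul_ne_zero h2 h3
      refine (smul_right_injective W h4) ?_
      simp only [h1, smul_add, smul_smul, mul_div_cancel₀ _ h4]
    · filter_upwards [hl 0] with x h1
      rw [sub_zero] at h1
      exact aWanted_insert hi h1
    · exact Eventually.of_forall fun x => aUnwanted_insert_self hi
    · intro i' hi'
      filter_upwards [hl 0, hl (2 * η), hl (-(2 * η)),
        hs.theta_ne i (Finset.mem_insert_self i S),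
        hs.theta_ne i' (Finset.mem_insert_of_mem hi')] with x h1 h2 h3 h4 h5
      rw [sub_zero] at h1
      rw [sub_neg_eq_add] at h3
      exact aUnwanted_insert hτ hi hi' h1 h2 h3 h4 h5 (ht_ne i i' fun h => hi (h ▸ hi'))

/-- The action of `d(s)` on a product of operators `b(t i)` applied to `v`. -/
lemma d_expansion (hτ : 0 < τ.im) (hΛ : Λ = 2 * (m : ℂ))
    (hW : M.IsHighestWeight Λ (fun _ _ => 1) (Dfun τ η Λ p q) v₀)
    {t : Fin m → ℂ} (ht : ∀ i, M.IsRegular (t i))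
    (ht_ne : ∀ i j, i ≠ j → theta τ (t i - t j) ≠ 0)
    (htq : ∀ i k, theta τ (t i - q k) ≠ 0) (c : ℂ)
    (S : Finset (Fin m)) (s : ℂ → ℂ) (hs : M.Admissible Λ p q v₀ t s S) :
    ∀ᶠ x in residual (ℂ × ℂ), M.op 1 1 s (M.bVec t (vFun τ η c m v₀) S) x =
      dWanted τ η c p q t s S x • M.bVec t (vFun τ η c m v₀) S x +
      ∑ i ∈ S, dUnwanted τ η c p q t s i S x •
        M.op 0 1 s (M.bVec t (vFun τ η c m v₀) (S.erase i)) x := by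
  have hv := memFunWeight_vFun (m := m) hτ c hW.mem
  have hl : ∀ a, ∀ᶠ x in residual (ℂ × ℂ), theta τ (x.2 - a) ≠ 0 := fun a =>
    eventually_residual_snd (eventually_theta_sub_ne_zero hτ a)
  refine op_expansion t (fun i => (ht i).good) _ (fun S => Λ - 2 * S.card)
    (genWeight_bVec ht hv) (bVec_insert ht hv) 1 _ _ (M.Admissible Λ p q v₀ t)
    (fun _ _ h => h.good) (fun _ _ _ h => h.mono (Finset.subset_insert _ _))
    (fun i S hi => admissible_const hτ hW (ht i) (htq i) fun j hj =>
      ht_ne j i fun h => hi (h ▸ hj)) ?_ ?_ S s hs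
  · intro s hs
    -- The factor θ(λ) produced by shifting the prefactor of v cancels the denominator of D, leaving
    -- θ(λ-4ηm)/θ(λ-2ηm).
    filter_upwards [hs.d_eq, hl 0, hl (2 * η * m)] with x h1 h2 h3
    rw [sub_zero] at h2
    have e : M.op 1 1 s (M.bVec t (vFun τ η c m v₀) ∅) x =
        vCoeff τ η c m (x.2 + 2 * η) • M.op 1 1 s (fun y => v₀ y.2) x := by
      simp [op, bVec, EModule.bProd, vFun, vCoeff]
    rw [e, h1, vCoeff_add η c m h3]
    simp only [dWanted, bVec, EModule.bProd, vFun, Finset.toList_empty, List.map_nil,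
      List.foldr_nil, Finset.prod_empty, Finset.card_empty, smul_smul, Dfun, dEig, hΛ]
    rw [show x.2 - 4 * η * ((m : ℂ) - ((0 : ℕ) : ℂ)) = x.2 - 2 * η * (2 * m) by push_cast; ring,
      show x.2 - 2 * η * ((m : ℂ) - ((0 : ℕ) : ℂ)) = x.2 - 2 * η * m by push_cast; ring]
    congr 1
    rw [vCoeff]
    field_simp
  · intro s i S hi hs
    -- Since Λ = 2m, the product over S has weight 2m - 2|S|. One more b lowers it by 2, and a is 2η
    -- times the resulting weight.
    set a : ℂ := 4 * η * (m - (S.card + 1)) with ha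
    refine ⟨fun x => theta τ (x.2 - a) * theta τ (t i - s x.1 + 2 * η) /
        (theta τ (x.2 - a - 2 * η) * theta τ (t i - s x.1)),
      fun x => -(theta τ (x.2 - a + (t i - s x.1)) * theta τ (2 * η)) /
        (theta τ (x.2 - a - 2 * η) * theta τ (t i - s x.1)), ?_, ?_, ?_, ?_⟩
    · filter_upwards [hs.good.op_db hτ (ht i).good (genWeight_bVec ht hv S) (a := a)
        (by rw [ha, hΛ]; ring), hl (a + 2 * η),
        hs.theta_ne i (Finset.mem_insert_self i S)] with x h1 h2 h3
      rw [sub_add_eq_sub_sub] at h2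
      have h4 := mul_ne_zero h2 h3
      refine (smul_right_injective W h4) ?_
      simp only [h1, smul_add, smul_smul, mul_div_cancel₀ _ h4, neg_smul]
      rw [sub_eq_add_neg]
    · filter_upwards [hl (a + 2 * η)] with x h1
      rw [sub_add_eq_sub_sub] at h1
      exact dWanted_insert hi rfl h1
    · filter_upwards [hl (a + 2 * η)] with x h1
      rw [sub_add_eq_sub_sub] at h1
      exact dUnwanted_insert_self hi rfl h1
    · intro i' hi'
      filter_upwards [hl (a + 2 * η),
        hs.theta_ne i (Finset.mem_insert_self i S),
        hs.theta_ne i' (Finset.mem_insert_of_mem hi')] with x h1 h4 h5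
      rw [sub_add_eq_sub_sub] at h1
      exact dUnwanted_insert hτ hi hi' rfl h1 h4 h5 (ht_ne i i' fun h => hi (h ▸ hi'))

end EModule

/-! ### The eigenvalue -/

section Eigval

variable {τ η c : ℂ} {n m : ℕ} {p q : Fin n → ℂ} {t : Fin m → ℂ}

lemma theta_sub_ne_zero (hτ : 0 < τ.im)
    (ht : ∀ i j, i < j → ∀ r s : ℤ, t i - t j ≠ r + s * τ) (i j : Fin m) (hij : i ≠ j) :
    theta τ (t i - t j) ≠ 0 := by
  intro h
  obtain ⟨r, s, hrs⟩ := mem_lattice_of_theta_eq_zero hτ h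
  rcases lt_or_gt_of_ne hij with h' | h'
  · exact ht i j h' r s hrs
  · refine ht j i h' (-r) (-s) ?_
    push_cast
    linear_combination -hrs

/-- The right-hand side of a Bethe equation is an exponential, so no numerator vanishes either.
Hence the Bethe roots avoid the poles of D. -/
lemma BetheEqs.theta_sub_ne_zero (h : BetheEqs τ η c p q t) (i : Fin m) (k : Fin n) :
    theta τ (t i - q k) ≠ 0 := by
  intro h0
  have h1 := h.2.2 i
  rw [Finset.prod_eq_zero (s := Finset.univ) (Finset.mem_univ k) (by rw [h0, zero_div]),
    mul_zero] at h1
  exact Complex.exp_ne_zero _ h1.symm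

/-- The Bethe equations as the cancellation of the unwanted terms. -/
lemma BetheEqs.cancel (h : BetheEqs τ η c p q t) (i : Fin m) :
    Complex.exp (-2 * η * c) *
        ∏ j ∈ Finset.univ.erase i, theta τ (t j - t i - 2 * η) / theta τ (t j - t i) =
      Complex.exp (2 * η * c) * dEig τ p q (t i) *
        ∏ j ∈ Finset.univ.erase i, theta τ (t j - t i + 2 * η) / theta τ (t j - t i) := by
  have h1 := h.2.2 i
  have hB : ∏ j ∈ Finset.univ.erase i, theta τ (t j - t i + 2 * η) ≠ 0 :=
    Finset.prod_ne_zero_iff.2 fun j hj => h.1 i j (Finset.ne_of_mem_erase hj)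
  have hP : ∏ k, theta τ (t i - p k) ≠ 0 := Finset.prod_ne_zero_iff.2 fun k _ => h.2.1 i k
  have hQ : ∏ k, theta τ (t i - q k) ≠ 0 :=
    Finset.prod_ne_zero_iff.2 fun k _ => h.theta_sub_ne_zero i k
  have he : Complex.exp (4 * η * c) = Complex.exp (2 * η * c) * Complex.exp (2 * η * c) := by
    rw [← Complex.exp_add]; congr 1; ring
  have he' : Complex.exp (-2 * η * c) * Complex.exp (2 * η * c) = 1 := by
    rw [← Complex.exp_add, show -2 * η * c + 2 * η * c = 0 by ring, Complex.exp_zero]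
  simp only [dEig, Finset.prod_div_distrib] at h1 ⊢
  rw [he] at h1
  clear he
  generalize Complex.exp (-2 * η * c) = X at *
  generalize Complex.exp (2 * η * c) = Y at *
  field_simp at h1
  rw [← mul_div_assoc, ← mul_div_assoc]
  congr 1
  field_simp
  linear_combination X * h1 + Y * (∏ j ∈ Finset.univ.erase i, theta τ (t j - t i + 2 * η)) *
    (∏ k, theta τ (t i - p k)) * he'

lemma theta_div_add_lattice (r s : ℤ) (a b : ℂ) :
    theta τ (a + (r + s * τ)) / theta τ (b + (r + s * τ)) =
      Complex.exp (-(2 * Real.pi * Complex.I * s * (a - b))) * (theta τ a / theta τ b) := by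
  obtain ⟨C, hC, h⟩ := theta_add_lattice (τ := τ) r s
  rw [h, h, show -(2 * Real.pi * Complex.I * s * (a - b)) =
    -(2 * Real.pi * Complex.I * s * a) - -(2 * Real.pi * Complex.I * s * b) by ring,
    Complex.exp_sub]
  have := Complex.exp_ne_zero (-(2 * Real.pi * Complex.I * s * b))
  field_simp

/-- Quasi-periodicity of the eigenvalue. -/
lemma eigval_add_lattice (hpq : ∑ k, (q k - p k) = 4 * η * m) (r s : ℤ) (w : ℂ) :
    eigval τ η c p q t (w + (r + s * τ)) =
      Complex.exp (-(4 * Real.pi * Complex.I * s * η * m)) * eigval τ η c p q t w := by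
  have h1 : ∀ e : ℂ, ∏ j, theta τ (t j - (w + (r + s * τ)) + e) / theta τ (t j - (w + (r + s * τ)))
      = Complex.exp (2 * Real.pi * Complex.I * s * e * m) *
        ∏ j, theta τ (t j - w + e) / theta τ (t j - w) := by
    intro e
    have : ∀ j, theta τ (t j - (w + (r + s * τ)) + e) / theta τ (t j - (w + (r + s * τ))) =
        Complex.exp (2 * Real.pi * Complex.I * s * e) *
          (theta τ (t j - w + e) / theta τ (t j - w)) := by
      intro j
      have := theta_div_add_lattice (τ := τ) (-r) (-s) (t j - w + e) (t j - w)
      push_cast at this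
      rw [show t j - (w + (r + s * τ)) + e = t j - w + e + (-r + -s * τ) by ring,
        show t j - (w + (r + s * τ)) = t j - w + (-r + -s * τ) by ring, this]
      congr 2; ring
    simp only [this, Finset.prod_mul_distrib, Finset.prod_const, Finset.card_univ,
      Fintype.card_fin, ← Complex.exp_nat_mul]
    congr 2; ring
  have h2 : ∏ k, theta τ (w + (r + s * τ) - p k) / theta τ (w + (r + s * τ) - q k) =
      Complex.exp (-(2 * Real.pi * Complex.I * s * (4 * η * m))) *
        ∏ k, theta τ (w - p k) / theta τ (w - q k) := by
    have : ∀ k, theta τ (w + (r + s * τ) - p k) / theta τ (w + (r + s * τ) - q k) =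
        Complex.exp (-(2 * Real.pi * Complex.I * s) * (q k - p k)) *
          (theta τ (w - p k) / theta τ (w - q k)) := by
      intro k
      rw [show w + (r + s * τ) - p k = w - p k + (r + s * τ) by ring,
        show w + (r + s * τ) - q k = w - q k + (r + s * τ) by ring, theta_div_add_lattice]
      congr 2; ring
    simp only [this, Finset.prod_mul_distrib, ← Complex.exp_sum, ← Finset.mul_sum, hpq]
    congr 2; ring
  have h3 := h1 (2 * η)
  have h4 := h1 (-(2 * η))
  simp only [← sub_eq_add_neg] at h4
  rw [eigval, eigval, h3, h4, h2]
  -- The two summands of ε acquire the same multiplier: in the second, e^{4πisηm} from the t-product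
  -- meets e^{-8πisηm} from the quotient over k, by ∑(q_k - p_k) = 4ηm.
  have e1 : Complex.exp (2 * Real.pi * Complex.I * s * -(2 * η) * m) =
      Complex.exp (-(4 * Real.pi * Complex.I * s * η * m)) := by congr 1; ring
  have e2 : Complex.exp (2 * Real.pi * Complex.I * s * (2 * η) * m) *
      Complex.exp (-(2 * Real.pi * Complex.I * s * (4 * η * m))) =
      Complex.exp (-(4 * Real.pi * Complex.I * s * η * m)) := by
    rw [← Complex.exp_add]; congr 1; ring
  rw [e1, ← e2]
  ring

lemma tendsto_div_of_hasDerivAt {f g : ℂ → ℂ} {f' g' x : ℂ} (hf : HasDerivAt f f' x)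
    (hg : HasDerivAt g g' x) (hfx : f x = 0) (hgx : g x = 0) (hg' : g' ≠ 0) :
    Tendsto (fun y => f y / g y) (𝓝[≠] x) (𝓝 (f' / g')) := by
  refine ((hasDerivAt_iff_tendsto_slope.1 hf).div (hasDerivAt_iff_tendsto_slope.1 hg) hg').congr' ?_
  filter_upwards [self_mem_nhdsWithin] with y hy
  have hy' : y - x ≠ 0 := sub_ne_zero.2 hy
  simp only [slope_def_field, hfx, hgx, sub_zero, Pi.div_apply]
  field_simp

/-- As θ'(0) ≠ 0, the denominator θ(t_i - w) has a simple zero at t_i. Multiplied by it, ε becomes a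
differentiable function whose value at t_i vanishes by the i-th Bethe equation. -/
lemma exists_tendsto_eigval_self (hτ : 0 < τ.im)
    (ht_ne : ∀ i j, i ≠ j → theta τ (t i - t j) ≠ 0) (h : BetheEqs τ η c p q t) (i : Fin m) :
    ∃ e, Tendsto (eigval τ η c p q t) (𝓝[≠] t i) (𝓝 e) := by
  have hθ := differentiable_theta hτ
  have hsub : ∀ a b : ℂ, Differentiable ℂ fun w => theta τ (a - w + b) := fun a b =>
    hθ.comp (show Differentiable ℂ fun w : ℂ => a - w + b by fun_prop)
  have hadd : ∀ a : ℂ, Differentiable ℂ fun w => theta τ (w - a) := fun a =>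
    hθ.comp (show Differentiable ℂ fun w : ℂ => w - a by fun_prop)
  -- The product over all j with the vanishing denominator θ(t_i - w) removed. The `+ 0` lets one
  -- differentiability lemma serve numerator and denominator.
  set Fe : ℂ → ℂ → ℂ := fun e w => theta τ (t i - w + e) *
    ∏ j ∈ Finset.univ.erase i, theta τ (t j - w + e) / theta τ (t j - w + 0) with hFe
  have hFd : ∀ e, DifferentiableAt ℂ (Fe e) (t i) := by
    intro e
    refine (hsub _ _ _).mul (DifferentiableAt.fun_finsetProd fun j hj => ?_)
    refine (hsub _ _ _).div (hsub _ _ _) ?_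
    rw [add_zero]
    exact ht_ne _ _ (Finset.ne_of_mem_erase hj)
  have hdd : DifferentiableAt ℂ (dEig τ p q) (t i) := by
    unfold dEig
    exact DifferentiableAt.fun_finsetProd fun k _ =>
      (hadd _ _).div (hadd _ _) (h.theta_sub_ne_zero i k)
  set F : ℂ → ℂ := fun w => Complex.exp (-2 * η * c) * Fe (-(2 * η)) w +
    Complex.exp (2 * η * c) * Fe (2 * η) w * dEig τ p q w with hF
  have hFdiff : DifferentiableAt ℂ F (t i) :=
    ((hFd _).const_mul _).add (((hFd _).const_mul _).mul hdd)
  have hF0 : F (t i) = 0 := by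
    have := h.cancel i
    simp only [hF, hFe, sub_self, zero_add, add_zero, theta_neg]
    simp only [← sub_eq_add_neg]
    linear_combination -theta τ (2 * η) * this
  have hg : HasDerivAt (fun w => theta τ (t i - w)) (-deriv (theta τ) 0) (t i) := by
    have := (hθ (t i - t i)).hasDerivAt.comp_const_sub (t i) (t i)
    rwa [sub_self] at this
  refine ⟨_, (tendsto_div_of_hasDerivAt hFdiff.hasDerivAt hg hF0 (by simp [theta_zero])
    (neg_ne_zero.2 (deriv_theta_zero_ne_zero hτ))).congr fun w => ?_⟩
  have hprod : ∀ e, ∏ j, theta τ (t j - w + e) / theta τ (t j - w) =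
      Fe e w / theta τ (t i - w) := by
    intro e
    rw [← Finset.mul_prod_erase _ _ (Finset.mem_univ i)]
    simp only [hFe, add_zero]
    ring
  have h1 := hprod (2 * η)
  have h2 := hprod (-(2 * η))
  simp only [← sub_eq_add_neg] at h2
  rw [eigval, h1, h2]
  simp only [hF, dEig]
  ring

lemma tendsto_sub_nhdsNE (x a : ℂ) : Tendsto (fun y : ℂ => y - a) (𝓝[≠] (x + a)) (𝓝[≠] x) := by
  refine tendsto_nhdsWithin_iff.2 ⟨?_, ?_⟩
  · have : Tendsto (fun y : ℂ => y - a) (𝓝 (x + a)) (𝓝 (x + a - a)) :=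
      (continuous_sub_right a).tendsto _
    rw [add_sub_cancel_right] at this
    exact this.mono_left nhdsWithin_le_nhds
  · filter_upwards [self_mem_nhdsWithin] with y hy
    simpa [sub_eq_iff_eq_add] using hy

/-- Such a w is a lattice translate of t_i, and quasi-periodicity transports the limit there. -/
lemma exists_tendsto_eigval_of_theta_eq_zero (hτ : 0 < τ.im)
    (hpq : ∑ k, (q k - p k) = 4 * η * m)
    (ht_ne : ∀ i j, i ≠ j → theta τ (t i - t j) ≠ 0) (h : BetheEqs τ η c p q t) {i : Fin m} {w : ℂ}
    (hw : theta τ (t i - w) = 0) : ∃ e, Tendsto (eigval τ η c p q t) (𝓝[≠] w) (𝓝 e) := by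
  obtain ⟨r, s, hrs⟩ := mem_lattice_of_theta_eq_zero hτ hw
  obtain ⟨e, he⟩ := exists_tendsto_eigval_self hτ ht_ne h i
  obtain rfl : w = t i + (((-r : ℤ) : ℂ) + ((-s : ℤ) : ℂ) * τ) := by
    push_cast
    linear_combination -hrs
  refine ⟨_, ((he.comp (tendsto_sub_nhdsNE _ _)).const_mul
    (Complex.exp (-(4 * Real.pi * Complex.I * (-s : ℤ) * η * m)))).congr fun y => ?_⟩
  rw [Function.comp_apply, ← eigval_add_lattice hpq (-r) (-s), sub_add_cancel]

lemma continuousAt_prod_theta_div (hτ : 0 < τ.im) {w : ℂ} (hw : ∀ j, theta τ (t j - w) ≠ 0)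
    (e : ℂ) : ContinuousAt (fun w => ∏ j, theta τ (t j - w + e) / theta τ (t j - w)) w := by
  have hθ := continuous_theta hτ
  exact tendsto_finsetProd _ fun j _ => ContinuousAt.div (f := fun w => theta τ (t j - w + e))
    (g := fun w => theta τ (t j - w)) (by fun_prop) (by fun_prop) (hw j)

/-- Away from the zeros of θ(t_j - w), only the factor `dEig` can be singular. The last clause
identifies the limit with the value of `eigval` when `dEig` is continuous along the filter. -/
lemma tendsto_eigval (hτ : 0 < τ.im) {w e : ℂ} {F : Filter ℂ} (hF : F ≤ 𝓝 w)
    (hw : ∀ j, theta τ (t j - w) ≠ 0) (he : Tendsto (dEig τ p q) F (𝓝 e)) :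
    ∃ e', Tendsto (eigval τ η c p q t) F (𝓝 e') ∧
      (e = dEig τ p q w → e' = eigval τ η c p q t w) := by
  have h1 := (continuousAt_prod_theta_div hτ hw (2 * η)).mono_left hF
  have h2 := (continuousAt_prod_theta_div hτ hw (-(2 * η))).mono_left hF
  simp only [← sub_eq_add_neg] at h2
  refine ⟨_, (h2.const_mul (Complex.exp (-2 * η * c))).add
    ((h1.const_mul (Complex.exp (2 * η * c))).mul he), ?_⟩
  rintro rfl
  rfl

lemma meromorphicAt_dEig (hτ : 0 < τ.im) (p q : Fin n → ℂ) (w : ℂ) :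
    MeromorphicAt (dEig τ p q) w := by
  have hθ := differentiable_theta hτ
  have hadd : ∀ a : ℂ, Differentiable ℂ fun w => theta τ (w - a) := fun a =>
    hθ.comp (show Differentiable ℂ fun w : ℂ => w - a by fun_prop)
  exact MeromorphicAt.fun_prod fun k _ =>
    ((hadd _).analyticAt w).meromorphicAt.div ((hadd _).analyticAt w).meromorphicAt

end Eigval

/-! ### The eigenvalue equation for generic spectral parameter. -/

lemma eventually_ne_codiscrete (w : ℂ) : ∀ᶠ y in codiscrete ℂ, y ≠ w := by
  change {y | y ≠ w} ∈ codiscrete ℂ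
  simp only [mem_codiscrete, disjoint_principal_right, compl_compl]
  intro x
  by_cases h : x = w
  · rw [h]; exact self_mem_nhdsWithin
  · exact mem_nhdsWithin_of_mem_nhds (isOpen_ne.mem_nhds h)

namespace EModule

variable {τ η Λ : ℂ} {W : Type*} [AddCommGroup W] [Module ℂ W] {M : EModule τ η W} {n m : ℕ}
  {p q : Fin n → ℂ} {v₀ : ℂ → W}

/-- At regular points the eigenvalue of `d` on the highest weight vector has a finite limit. -/
lemma IsHighestWeight.exists_tendsto_dEig (hτ : 0 < τ.im)
    (hW : M.IsHighestWeight Λ (fun _ _ => 1) (Dfun τ η Λ p q) v₀) {w : ℂ} (hw : M.IsRegular w) :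
    ∃ e, Tendsto (dEig τ p q) (𝓝[≠] w) (𝓝 e) := by
  have hθ := continuous_theta hτ
  have hmer := meromorphicAt_dEig hτ p q w
  rw [tendsto_nhds_iff_meromorphicOrderAt_nonneg hmer]
  -- A pole would make `dEig` unbounded near w. Yet, after pairing with a functional φ, `dEig`
  -- agrees generically with the quotient of φ(d(y)v₀) by the scalar `den`, which is continuous at
  -- (w,l) for a suitable l.
  by_contra! hneg
  have hinf := tendsto_cobounded_of_meromorphicOrderAt_neg hneg
  have hv : ∃ᶠ l in codiscrete ℂ, v₀ l ≠ 0 := not_eventually.1 hW.ne_zero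
  obtain ⟨l, hl0, h1, h2, h3, h4⟩ := (hv.and_eventually
    ((hw.eventually_vcont_entry hW.mem 1 1).and ((eventually_vcont_snd hW.mem.1 w).and
      ((eventually_theta_ne_zero hτ).and (eventually_theta_sub_ne_zero hτ (2 * η * Λ)))))).exists
  obtain ⟨φ, hφ⟩ : ∃ φ : Module.Dual ℂ W, φ (v₀ l) ≠ 0 := by
    by_contra! h
    exact hl0 ((Module.forall_dual_apply_eq_zero_iff ℂ _).1 h)
  set den : ℂ × ℂ → ℂ := fun y => theta τ (y.2 - 2 * η * Λ) / theta τ y.2 * φ (v₀ y.2) with hden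
  have hdc : ContinuousAt den (w, l) :=
    (ContinuousAt.div (f := fun y : ℂ × ℂ => theta τ (y.2 - 2 * η * Λ))
      (g := fun y : ℂ × ℂ => theta τ y.2) (by fun_prop) (by fun_prop) h3).mul
      (h2.continuousAt_dual φ)
  have hd0 : den (w, l) ≠ 0 := mul_ne_zero (div_ne_zero h4 h3) hφ
  have hG : ContinuousAt (fun y => φ (M.entry 1 1 y.1 v₀ y.2) / den y) (w, l) :=
    (h1.continuousAt_dual φ).div hdc hd0
  set B := ‖φ (M.entry 1 1 w v₀ l) / den (w, l)‖ + 1 with hB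
  have hbd : ∀ᶠ y in 𝓝 (w, l), ‖φ (M.entry 1 1 y.1 v₀ y.2) / den y‖ < B :=
    hG.norm.eventually_lt_const (by simp [hB])
  have hbig : ∀ᶠ y in 𝓝[≠] w, B < ‖dEig τ p q y‖ :=
    (tendsto_norm_atTop_iff_cobounded.2 hinf).eventually_gt_atTop B
  have hbig' : ∀ᶠ y : ℂ × ℂ in 𝓝 (w, l), y.1 ≠ w → B < ‖dEig τ p q y.1‖ :=
    ((continuousAt_fst (p := (w, l))).eventually (eventually_nhdsWithin_iff.1 hbig)).mono
      fun _ hy h => hy h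
  have hdense := dense_of_mem_residual ((eventually_residual_of_dense_interior hW.d_eq).and
    (eventually_residual_fst (eventually_ne_codiscrete w)))
  have hfreq := mem_closure_iff_frequently.1 (hdense (w, l))
  obtain ⟨y, ⟨hy1, hy2⟩, hy3, hy4, hy5⟩ :=
    (hfreq.and_eventually (hbd.and (hbig'.and (hdc.eventually_ne hd0)))).exists
  have e : φ (M.entry 1 1 y.1 v₀ y.2) / den y = dEig τ p q y.1 := by
    rw [show M.entry 1 1 y.1 v₀ y.2 = Dfun τ η Λ p q y.1 y.2 • v₀ y.2 from hy1,
      div_eq_iff hy5, map_smul, smul_eq_mul, hden, Dfun, dEig]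
    ring
  rw [e] at hy3
  exact lt_asymm hy3 (hy4 hy2)

/-- The Bethe vector is an eigenvector of the transfer matrix with generic spectral parameter. -/
theorem eventually_T_eq (hτ : 0 < τ.im) (hΛ : Λ = 2 * (m : ℂ))
    (hW : M.IsHighestWeight Λ (fun _ _ => 1) (Dfun τ η Λ p q) v₀)
    {t : Fin m → ℂ} (ht : ∀ i, M.IsRegular (t i))
    (ht_ne : ∀ i j, i ≠ j → theta τ (t i - t j) ≠ 0) {c : ℂ} (h : BetheEqs τ η c p q t) :
    ∀ᶠ x in residual (ℂ × ℂ), M.T x.1 (M.bProd (List.ofFn t) (vFun τ η c m v₀)) x.2 =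
      eigval τ η c p q t x.1 • M.bProd (List.ofFn t) (vFun τ η c m v₀) x.2 := by
  have hv := memFunWeight_vFun (m := m) hτ c hW.mem
  have hψ : M.bVec t (vFun τ η c m v₀) Finset.univ =ᶠ[residual (ℂ × ℂ)]
      fun x => M.bProd (List.ofFn t) (vFun τ η c m v₀) x.2 := by
    refine bProd_perm hv ?_ fun z hz => ?_
    · rw [List.ofFn_eq_map]
      refine List.Perm.map t ((List.perm_ext_iff_of_nodup (Finset.nodup_toList _)
        (List.nodup_finRange m)).2 fun i => ?_)
      simp
    · obtain ⟨j, _, rfl⟩ := List.mem_map.1 hz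
      exact ht j
  have had := admissible_id (m := m) hτ hW t Finset.univ
  filter_upwards [a_expansion hτ hW ht ht_ne h.theta_sub_ne_zero c _ _ had,
    d_expansion hτ hΛ hW ht ht_ne h.theta_sub_ne_zero c _ _ had, hψ,
    op_congr (M := M) (i := 0) (j := 0) (s := id) hψ,
    op_congr (M := M) (i := 1) (j := 1) (s := id) hψ,
    eventually_residual_snd (eventually_theta_ne_zero hτ),
    eventually_residual_snd (eventually_theta_sub_ne_zero hτ (2 * η))] with x ha hd h1 h2 h3 h4 h5
  have hT : M.T x.1 (M.bProd (List.ofFn t) (vFun τ η c m v₀)) x.2 =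
      M.op 0 0 id (fun x => M.bProd (List.ofFn t) (vFun τ η c m v₀) x.2) x +
      M.op 1 1 id (fun x => M.bProd (List.ofFn t) (vFun τ η c m v₀) x.2) x := rfl
  -- For the full index set both unwanted coefficients contain θ(λ+t_i-w)θ(2η)/(θ(t_i-w)θ(λ)), so
  -- their sum vanishes by the Bethe equation.
  have hun : ∀ i, dUnwanted τ η c p q t id i Finset.univ x =
      -aUnwanted τ η c t id i Finset.univ x := by
    intro i
    have := h.cancel i
    simp only [aUnwanted, dUnwanted, Finset.card_univ, Fintype.card_fin, sub_self, mul_zero,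
      sub_zero, zero_sub, mul_neg, mul_one, ← sub_eq_add_neg]
    rw [mul_div_cancel_right₀ _ h5]
    simp only [id]
    linear_combination (theta τ (x.2 + (t i - x.1)) * theta τ (2 * η) /
      (theta τ (t i - x.1) * theta τ x.2)) * this
  have hwa : aWanted τ η c t id Finset.univ x + dWanted τ η c p q t id Finset.univ x =
      eigval τ η c p q t x.1 := by
    simp only [aWanted, dWanted, eigval, dEig, Finset.card_univ, Fintype.card_fin, sub_self,
      mul_zero, sub_zero, zero_sub, mul_neg, mul_one, ← sub_eq_add_neg, id]
    field_simp
  rw [hT, ← h2, ← h3, ha, hd, ← hwa, ← h1]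
  simp only [hun, neg_smul, Finset.sum_neg_distrib]
  module

end EModule

end EllipticBethe

end

/-! ### The eigenvalue equation at every regular point. -/

theorem mainTheorem1 (τ η c : ℂ) (hτ : 0 < τ.im) {W : Type*} [AddCommGroup W] [Module ℂ W]
    (M : EllipticBethe.EModule τ η W) (n m : ℕ) (z Λs : Fin n → ℂ) (p q : Fin n → ℂ)
    (hp : p = EllipticBethe.pPt η z Λs) (hq : q = EllipticBethe.qPt η z Λs)
    (Λ : ℂ) (hΛs : Λ = ∑ j, Λs j) (hΛ : Λ = 2 * (m : ℂ)) (v₀ : ℂ → W)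
    (hW : M.IsHighestWeight Λ (fun _ _ => 1) (EllipticBethe.Dfun τ η Λ p q) v₀)
    (t : Fin m → ℂ) (ht_reg : ∀ i, M.IsRegular (t i))
    (ht_distinct : ∀ i j, i < j → ∀ r s : ℤ, t i - t j ≠ r + s * τ)
    (ht_bethe : EllipticBethe.BetheEqs τ η c p q t)
    (ψ : ℂ → W) (hψ : ψ = M.bProd (List.ofFn t) (EllipticBethe.vFun τ η c m v₀)) :
    M.MemFunWeight 0 ψ ∧
    ∀ w : ℂ, M.IsRegular w →
      ((∀ j, EllipticBethe.theta τ (t j - w) ≠ 0) → (∀ k, EllipticBethe.theta τ (w - q k) ≠ 0) →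
        M.T w ψ =ᶠ[Filter.codiscrete ℂ] EllipticBethe.eigval τ η c p q t w • ψ) ∧
      ∃ e : ℂ, Filter.Tendsto (EllipticBethe.eigval τ η c p q t) (nhdsWithin w {w}ᶜ) (nhds e) ∧
        M.T w ψ =ᶠ[Filter.codiscrete ℂ] e • ψ := by
  have ht_ne := EllipticBethe.theta_sub_ne_zero hτ ht_distinct
  have hpq : ∑ k, (q k - p k) = 4 * η * m := by
    have h1 : ∀ k, q k - p k = 2 * η * Λs k := fun k => by
      rw [hp, hq, EllipticBethe.pPt, EllipticBethe.qPt]; ring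
    simp only [h1, ← Finset.mul_sum, ← hΛs, hΛ]
    ring
  have hmem : M.MemFunWeight 0 ψ := by
    have h := (EllipticBethe.EModule.memFunWeight_vFun (m := m) hτ c hW.mem).bProd (List.ofFn t)
      fun y hy => by
        obtain ⟨j, rfl⟩ := List.mem_ofFn.1 hy
        exact ht_reg j
    rwa [List.length_ofFn, hΛ, sub_self, ← hψ] at h
  have hgen := EllipticBethe.EModule.eventually_T_eq hτ hΛ hW ht_reg ht_ne ht_bethe
  rw [← hψ] at hgen
  refine ⟨hmem, fun w hw => ?_⟩
  have key : ∀ e : ℂ, Tendsto (EllipticBethe.eigval τ η c p q t) (𝓝[≠] w) (𝓝 e) →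
      M.T w ψ =ᶠ[codiscrete ℂ] e • ψ := by
    intro e he
    filter_upwards [hw.eventually_vcont_entry hmem 0 0, hw.eventually_vcont_entry hmem 1 1,
      EllipticBethe.EModule.eventually_vcont_snd hmem.1 w] with l h1 h2 h3
    -- If a denominator vanishes at w, the value of `eigval` there is meaningless. Replacing it by
    -- the limit e gives a function continuous at w and unchanged at generic points.
    have hc : ContinuousAt (fun y : ℂ × ℂ =>
        Function.update (EllipticBethe.eigval τ η c p q t) w e y.1) (w, l) :=
      ContinuousAt.comp (x := (w, l)) (f := Prod.fst)
        (g := Function.update (EllipticBethe.eigval τ η c p q t) w e)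
        (continuousAt_update_same.2 he) continuousAt_fst
    have h4 := (h1.add h2).eq_of_residual (h3.smul hc) ?_
    · simp only [Function.update_self] at h4
      exact h4
    filter_upwards [hgen, EllipticBethe.eventually_residual_fst
      (EllipticBethe.eventually_ne_codiscrete w)] with y hy hyw
    rw [Function.update_of_ne hyw]
    exact hy
  refine ⟨fun htw hqw => ?_, ?_⟩
  · obtain ⟨e, he, h⟩ := EllipticBethe.tendsto_eigval (η := η) (c := c) hτ
      (nhdsWithin_le_nhds (s := {w}ᶜ)) htw
      ((EllipticBethe.continuousAt_dEig hτ p hqw).mono_left nhdsWithin_le_nhds)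
    rw [← h rfl]
    exact key e he
  · obtain ⟨e, he⟩ : ∃ e, Tendsto (EllipticBethe.eigval τ η c p q t) (𝓝[≠] w) (𝓝 e) := by
      -- Poles of the two kinds are excluded for different reasons: zeros of θ(w - q_k) by
      -- regularity of w, zeros of θ(t_j - w) by the Bethe equations. In the second case continuity
      -- of `dEig` at t_j also comes from the Bethe equations.
      by_cases htw : ∀ j, EllipticBethe.theta τ (t j - w) ≠ 0
      · obtain ⟨e, he⟩ := hW.exists_tendsto_dEig hτ hw
        obtain ⟨e', he', _⟩ := EllipticBethe.tendsto_eigval (η := η) (c := c) hτ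
          (nhdsWithin_le_nhds (s := {w}ᶜ)) htw he
        exact ⟨e', he'⟩
      · push Not at htw
        obtain ⟨i, hi⟩ := htw
        exact EllipticBethe.exists_tendsto_eigval_of_theta_eq_zero hτ hpq ht_ne ht_bethe hi
    exact ⟨e, he, key e he⟩
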